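/- Let $\Theta$ be a nonempty set of atomic propositions. Let $\mathcal L_C$ be the set of classical propositional formulas built from $\Theta$ by $\neg$ and $\to$, and let $\mathcal L\supset\mathcal L_C$ be the set of formulas built from $\Theta$ by $\neg$, $\to$, a unary modality $\Box$ and a binary conditional $(\psi|\phi)$. Write $\phi\vee\psi=\neg\phi\to\psi$, $\phi\wedge\psi=\neg(\neg\phi\vee\neg\psi)$, $\phi\leftrightarrow\psi=(\phi\to\psi)\wedge(\psi\to\phi)$, $\top=\theta\to\theta$ for a chosen $\theta\in\Theta$, $\bot=\neg\top$, and $\psi\times\phi=\Box\bigl((\psi|\phi)\leftrightarrow\psi\bigr)$ (logical independence). Classical logic $C$ on $\mathcal L_C$ has modus ponens and the axiom schemes $\phi\to(\psi\to\phi)$; $(\eta\to(\phi\to\psi))\to((\eta\to\phi)\to(\eta\to\psi))$; $(\neg\phi\to\neg\psi)\to((\neg\phi\to\psi)\to\phi)$. The logic DmBL on $\mathcal L$ has the same rule and schemes (for formulas of $\mathcal L$), the rule "$\vdash\phi$ implies $\vdash\Box\phi$", and the axiom schemes $$\Box(\phi\to\psi)\to(\Box\phi\to\Box\psi),\qquad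 \Box\phi\to\phi,\qquad \Box(\phi\to\psi)\to\bigl(\Box\neg\phi\vee\Box(\psi|\phi)\bigr),$$ $$(\psi\to\eta|\phi)\to\bigl((\psi|\phi)\to(\eta|\phi)\bigr),\qquad (\psi|\phi)\to(\phi\to\psi),\qquad \neg(\neg\psi|\phi)\leftrightarrow(\psi|\phi),\qquad (\psi\times\phi)\leftrightarrow(\phi\times\psi).$$ Write $\vdash_C$ and $\vdash$ for provability in $C$ and in DmBL. A probability over $C$ is a function $\pi:\mathcal L_C\to[0,\infty)$ such that, for all $\phi,\psi\in\mathcal L_C$: $\vdash_C\phi\leftrightarrow\psi$ implies $\pi(\phi)=\pi(\psi)$; $\pi(\phi\wedge\psi)+\pi(\phi\vee\psi)=\pi(\phi)+\pi(\psi)$; $\pi(\bot)=0$; $\pi(\top)=1$. A (multiplicative) probability over DmBL is a function $P:\mathcal L\to[0,\infty)$ such that, for all $\phi,\psi\in\mathcal L$: $\vdash\phi\leftrightarrow\psi$ implies $P(\phi)=P(\psi)$; $P(\phi\wedge\psi)+P(\phi\vee\psi)=P(\phi)+P(\psi)$; $P(\bot)=0$; $P(\top)=1$; and $\vdash\phi\times\psi$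 implies $P(\phi\wedge\psi)=P(\phi)P(\psi)$. **Theorem.** For every probability $\pi$ over $C$ there is a (multiplicative) probability $\overline\pi$ over DmBL such that $\overline\pi(\phi)=\pi(\phi)$ for every $\phi\in\mathcal L_C$. -/

import Mathlib

namespace DmBL

/-- The classical language over the set `Θ` of atomic propositions: built from atoms by
negation and implication. -/
inductive CFormula (Θ : Type*) : Type _
  | atom (θ : Θ) : CFormula Θ
  | neg (φ : CFormula Θ) : CFormula Θ
  | imp (φ ψ : CFormula Θ) : CFormula Θ

/-- The language of DmBL over `Θ`: atoms, negation, implication, the modality `□`, and the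
conditional.  `cond ψ φ` stands for `(ψ | φ)`, i.e. "`ψ` given `φ`". -/
inductive Formula (Θ : Type*) : Type _
  | atom (θ : Θ) : Formula Θ
  | neg (φ : Formula Θ) : Formula Θ
  | imp (φ ψ : Formula Θ) : Formula Θ
  | box (φ : Formula Θ) : Formula Θ
  | cond (ψ φ : Formula Θ) : Formula Θ

namespace CFormula

variable {Θ : Type*}

/-- `φ ∨ ψ` abbreviates `¬φ → ψ`. -/
def or (φ ψ : CFormula Θ) : CFormula Θ := φ.neg.imp ψ

/-- `φ ∧ ψ` abbreviates `¬(¬φ ∨ ¬ψ)`. -/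
def and (φ ψ : CFormula Θ) : CFormula Θ := (φ.neg.or ψ.neg).neg

/-- `φ ↔ ψ` abbreviates `(φ → ψ) ∧ (ψ → φ)`. -/
def iff (φ ψ : CFormula Θ) : CFormula Θ := (φ.imp ψ).and (ψ.imp φ)

/-- `⊤` abbreviates `θ → θ` for a chosen atom `θ`. -/
def top (θ : Θ) : CFormula Θ := (atom θ).imp (atom θ)

/-- `⊥` abbreviates `¬⊤`. -/
def bot (θ : Θ) : CFormula Θ := (top θ).neg

/-- Proofs in classical propositional logic `C`. -/
inductive Provable : CFormula Θ → Prop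
  | c1 (φ ψ : CFormula Θ) : Provable (φ.imp (ψ.imp φ))
  | c2 (η φ ψ : CFormula Θ) :
      Provable ((η.imp (φ.imp ψ)).imp ((η.imp φ).imp (η.imp ψ)))
  | c3 (φ ψ : CFormula Θ) :
      Provable ((φ.neg.imp ψ.neg).imp ((φ.neg.imp ψ).imp φ))
  | modusPonens {φ ψ : CFormula Θ} : Provable φ → Provable (φ.imp ψ) → Provable ψ

/-- Logical equivalence in `C`: `⊢ φ ↔ ψ`. -/
def Equivalent (φ ψ : CFormula Θ) : Prop := Provable (φ.iff ψ)

/-- The inclusion of the classical language into the language of DmBL. -/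
def toFormula : CFormula Θ → Formula Θ
  | atom θ => Formula.atom θ
  | neg φ => Formula.neg φ.toFormula
  | imp φ ψ => Formula.imp φ.toFormula ψ.toFormula

/-- Probabilities over `C` (`θ` is the atom used to write `⊤` and `⊥`). -/
structure IsProbability (θ : Θ) (π : CFormula Θ → ℝ) : Prop where
  nonneg : ∀ φ, 0 ≤ π φ
  equivalence : ∀ φ ψ, Equivalent φ ψ → π φ = π ψ
  additivity : ∀ φ ψ, π (φ.and ψ) + π (φ.or ψ) = π φ + π ψ
  coherence : π (bot θ) = 0
  finiteness : π (top θ) = 1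

end CFormula

namespace Formula

variable {Θ : Type*}

/-- `φ ∨ ψ` abbreviates `¬φ → ψ`. -/
def or (φ ψ : Formula Θ) : Formula Θ := φ.neg.imp ψ

/-- `φ ∧ ψ` abbreviates `¬(¬φ ∨ ¬ψ)`. -/
def and (φ ψ : Formula Θ) : Formula Θ := (φ.neg.or ψ.neg).neg

/-- `φ ↔ ψ` abbreviates `(φ → ψ) ∧ (ψ → φ)`. -/
def iff (φ ψ : Formula Θ) : Formula Θ := (φ.imp ψ).and (ψ.imp φ)

/-- `⊤` abbreviates `θ → θ` for a chosen atom `θ`. -/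
def top (θ : Θ) : Formula Θ := (atom θ).imp (atom θ)

/-- `⊥` abbreviates `¬⊤`. -/
def bot (θ : Θ) : Formula Θ := (top θ).neg

/-- Logical independence: `ψ × φ` abbreviates `□((ψ | φ) ↔ ψ)`. -/
def indep (ψ φ : Formula Θ) : Formula Θ := ((cond ψ φ).iff ψ).box

/-- Proofs in DmBL: classical schemes, modus ponens, system T, and the Bayesian schemes. -/
inductive Provable : Formula Θ → Prop
  | c1 (φ ψ : Formula Θ) : Provable (φ.imp (ψ.imp φ))
  | c2 (η φ ψ : Formula Θ) :
      Provable ((η.imp (φ.imp ψ)).imp ((η.imp φ).imp (η.imp ψ)))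
  | c3 (φ ψ : Formula Θ) :
      Provable ((φ.neg.imp ψ.neg).imp ((φ.neg.imp ψ).imp φ))
  | modusPonens {φ ψ : Formula Θ} : Provable φ → Provable (φ.imp ψ) → Provable ψ
  | m1 {φ : Formula Θ} : Provable φ → Provable φ.box
  | m2 (φ ψ : Formula Θ) : Provable ((φ.imp ψ).box.imp (φ.box.imp ψ.box))
  | m3 (φ : Formula Θ) : Provable (φ.box.imp φ)
  | b1 (φ ψ : Formula Θ) :
      Provable ((φ.imp ψ).box.imp (φ.neg.box.or (cond ψ φ).box))
  | b2 (φ ψ η : Formula Θ) :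
      Provable ((cond (ψ.imp η) φ).imp ((cond ψ φ).imp (cond η φ)))
  | b3 (φ ψ : Formula Θ) : Provable ((cond ψ φ).imp (φ.imp ψ))
  | b4 (φ ψ : Formula Θ) : Provable ((cond ψ.neg φ).neg.iff (cond ψ φ))
  | b5 (φ ψ : Formula Θ) : Provable ((ψ.indep φ).iff (φ.indep ψ))

/-- Logical equivalence in DmBL: `⊢ φ ↔ ψ`. -/
def Equivalent (φ ψ : Formula Θ) : Prop := Provable (φ.iff ψ)

/-- (Multiplicative) probabilities over DmBL (`θ` is the atom used to write `⊤` and `⊥`). -/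
structure IsProbability (θ : Θ) (P : Formula Θ → ℝ) : Prop where
  nonneg : ∀ φ, 0 ≤ P φ
  equivalence : ∀ φ ψ, Equivalent φ ψ → P φ = P ψ
  additivity : ∀ φ ψ, P (φ.and ψ) + P (φ.or ψ) = P φ + P ψ
  coherence : P (bot θ) = 0
  finiteness : P (top θ) = 1
  multiplicativity : ∀ φ ψ, Provable (φ.indep ψ) → P (φ.and ψ) = P φ * P ψ

end Formula

end DmBL

/-! The probability comes from algebraic models. In a Boolean algebra `B`, read `□` as the
two-valued test "equals `⊤`" and the conditional as an operation `h`. If `h` satisfies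
`IsConditioning`, every theorem of DmBL evaluates to `⊤`. A charge `μ` on `B` then induces a
multiplicative probability as soon as `h φ ψ = ψ` forces `φ` and `ψ` to be `μ`-independent.

Such an `h` is obtained from a symmetric relation `R` of independence whose fibers are Boolean
subalgebras. If `μ` vanishes only at `⊥`, an element of the fiber of `φ ≠ ⊥` is determined by its
trace on `φ`. If moreover every trace on `φ` is attained in the fiber, `h φ ψ` is the element of the
fiber with the trace of `ψ`. It is a Boolean homomorphism in `ψ`, its fixed points are the `ψ` with
`R φ ψ`, and the symmetry of `R` validates the last axiom.

The algebra is that of periodic sets of naturals, with density as the charge.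
`exists_conditional_of_indep` adds one missing trace by means of a fresh digit,
`IsBoundedIndepRel.exists_extension` enlarges the relation accordingly, and countability allows all
demands to be met in a directed union (`exists_saturated_isIndepRel`).

Finally, on finitely many formulas `π` is a finite mixture of valuations, by completeness of `C`.
Rounding the weights to multiples of `1 / N` realizes the mixture approximately by periodic sets.
Multiplicative probabilities form a closed set in a product of intervals, so compactness turns
approximation into equality. -/

namespace DmBL

/-! ### Algebraic semantics and soundness of DmBL -/

open Classical in
/-- Interpretation of formulas in a Boolean algebra, with `□` read as "is equal to `⊤`" and
`(ψ | φ)` read as `h φ ψ`. -/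
noncomputable def Formula.eval {Θ B : Type*} [BooleanAlgebra B] (h : B → B → B) (v : Θ → B) :
    Formula Θ → B
  | .atom θ => v θ
  | .neg φ => (φ.eval h v)ᶜ
  | .imp φ ψ => φ.eval h v ⇨ ψ.eval h v
  | .box φ => if φ.eval h v = ⊤ then ⊤ else ⊥
  | .cond ψ φ => h (φ.eval h v) (ψ.eval h v)

/-- The algebraic conditions on `h φ ψ = (ψ | φ)` which make the axioms of DmBL valid. -/
structure IsConditioning {B : Type*} [BooleanAlgebra B] (h : B → B → B) : Prop where
  eq_top : ∀ φ ψ, φ ≠ ⊥ → φ ≤ ψ → h φ ψ = ⊤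
  himp_le : ∀ φ ψ η, h φ (ψ ⇨ η) ≤ h φ ψ ⇨ h φ η
  inf_le : ∀ φ ψ, h φ ψ ⊓ φ ≤ ψ
  compl : ∀ φ ψ, h φ ψᶜ = (h φ ψ)ᶜ
  fixed_comm : ∀ φ ψ, h φ ψ = ψ ↔ h ψ φ = φ

/-- A normalized finitely additive measure on a Boolean algebra. -/
structure IsCharge {B : Type*} [BooleanAlgebra B] (μ : B → ℝ) : Prop where
  nonneg : ∀ a, 0 ≤ μ a
  inf_add_sup : ∀ a b, μ (a ⊓ b) + μ (a ⊔ b) = μ a + μ b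
  bot : μ ⊥ = 0
  top : μ ⊤ = 1

section Eval

variable {Θ B : Type*} [BooleanAlgebra B] {h : B → B → B} {v : Θ → B}

namespace Formula

theorem eval_or (φ ψ : Formula Θ) : (φ.or ψ).eval h v = φ.eval h v ⊔ ψ.eval h v := by
  simp [Formula.or, eval, _root_.himp_eq, sup_comm]

theorem eval_and (φ ψ : Formula Θ) : (φ.and ψ).eval h v = φ.eval h v ⊓ ψ.eval h v := by
  have := eval_or (h := h) (v := v) φ.neg ψ.neg
  simp only [Formula.and, eval] at this ⊢
  rw [this, compl_sup, compl_compl, compl_compl]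

theorem eval_iff_eq_top (φ ψ : Formula Θ) :
    (φ.iff ψ).eval h v = ⊤ ↔ φ.eval h v = ψ.eval h v := by
  rw [Formula.iff, eval_and]
  simp only [eval, inf_eq_top_iff, himp_eq_top_iff]
  exact ⟨fun h => le_antisymm h.1 h.2, fun h => ⟨h.le, h.ge⟩⟩

open Classical in
theorem eval_indep (φ ψ : Formula Θ) : (ψ.indep φ).eval h v =
    if h (φ.eval h v) (ψ.eval h v) = ψ.eval h v then ⊤ else ⊥ := by
  simp only [indep, eval, eval_iff_eq_top]

/-- Each Bayesian scheme matches one field of `IsConditioning`. In `b1` the disjunct `□¬φ` absorbs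
the case where `φ` has value `⊥`, which is why `eq_top` may exclude it. -/
theorem Provable.eval_eq_top (hh : IsConditioning h) {φ : Formula Θ} (hφ : Provable φ) :
    φ.eval h v = ⊤ := by
  induction hφ with
  | c1 φ ψ => simp [eval]
  | c2 η φ ψ =>
    simp only [eval, himp_eq_top_iff, le_himp_iff]
    refine le_trans (le_inf ?_ ?_) (himp_inf_le (a := φ.eval h v))
    · exact le_trans (inf_le_inf_right _ inf_le_left) himp_inf_le
    · exact le_trans (inf_le_inf_right _ inf_le_right) himp_inf_le
  | c3 φ ψ =>
    simp only [eval, himp_eq_top_iff, le_himp_iff]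
    simp only [_root_.himp_eq, compl_compl, sup_comm _ (φ.eval h v), ← sup_inf_left]
    simp
  | modusPonens _ _ ih₁ ih₂ => simpa [eval, ih₁] using ih₂
  | m1 _ ih => simp [eval, ih]
  | m2 φ ψ =>
    simp only [eval, himp_eq_top_iff, le_himp_iff]
    by_cases h₁ : φ.eval h v = ⊤ <;> by_cases h₂ : ψ.eval h v = ⊤ <;> simp [h₁, h₂]
  | m3 φ =>
    simp only [eval, himp_eq_top_iff]
    split_ifs with h₁ <;> simp_all
  | b1 φ ψ =>
    have := hh.eq_top (φ.eval h v) (ψ.eval h v)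
    simp only [eval, eval_or, himp_eq_top_iff, compl_eq_top]
    by_cases h₁ : φ.eval h v = ⊥
    · simp [h₁]
    · by_cases h₂ : φ.eval h v ≤ ψ.eval h v <;> simp_all
  | b2 φ ψ η => simpa [eval] using hh.himp_le _ _ _
  | b3 φ ψ => simpa [eval] using hh.inf_le _ _
  | b4 φ ψ => simp [eval_iff_eq_top, eval, hh.compl]
  | b5 φ ψ =>
    rw [eval_iff_eq_top, eval_indep, eval_indep]
    classical exact if_congr (hh.fixed_comm _ _) rfl rfl

/-- A charge on a Boolean algebra with conditioning induces a probability over DmBL, as soon as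
the fixed points of conditioning are independent of the condition. -/
theorem isProbability_eval (hh : IsConditioning h) {μ : B → ℝ} (hμ : IsCharge μ)
    (hm : ∀ φ ψ, h φ ψ = ψ → μ (φ ⊓ ψ) = μ φ * μ ψ) (θ : Θ) :
    IsProbability θ fun φ : Formula Θ => μ (φ.eval h v) where
  nonneg _ := hμ.nonneg _
  equivalence φ ψ he := by
    rw [(eval_iff_eq_top φ ψ).1 (Provable.eval_eq_top hh he)]
  additivity φ ψ := by simpa only [eval_or, eval_and] using hμ.inf_add_sup _ _
  coherence := by simp [bot, top, eval, hμ.bot]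
  finiteness := by simp [top, eval, hμ.top]
  multiplicativity φ ψ hp := by
    have := Provable.eval_eq_top (v := v) hh hp
    rw [eval_indep] at this
    split_ifs at this with hf
    · simp only [eval_and]
      rw [inf_comm, hm _ _ hf, mul_comm]
    -- Here `⊥ = ⊤`: the algebra is trivial and both sides are zero.
    · have h₁ : ∀ a : B, a = ⊥ := fun a => le_bot_iff.1 (this.symm ▸ le_top)
      simp [h₁, hμ.bot]

end Formula

end Eval

/-! ### From independence relations to conditioning -/

section Charge

variable {B : Type*} [BooleanAlgebra B] {μ : B → ℝ}

theorem IsCharge.sup_of_inf_eq_bot (hμ : IsCharge μ) {a b : B} (h : a ⊓ b = ⊥) :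
    μ (a ⊔ b) = μ a + μ b := by
  simpa [h, hμ.bot] using hμ.inf_add_sup a b

theorem IsCharge.inf_add_inf_compl (hμ : IsCharge μ) (a b : B) :
    μ (a ⊓ b) + μ (a ⊓ bᶜ) = μ a := by
  rw [← hμ.sup_of_inf_eq_bot, ← inf_sup_left, sup_compl_eq_top, inf_top_eq]
  rw [inf_inf_inf_comm, inf_compl_eq_bot, inf_bot_eq]

theorem IsCharge.compl (hμ : IsCharge μ) (a : B) : μ aᶜ = 1 - μ a := by
  have := hμ.inf_add_inf_compl ⊤ a
  simp only [top_inf_eq, hμ.top] at this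
  linarith

theorem IsCharge.le_one (hμ : IsCharge μ) (a : B) : μ a ≤ 1 := by
  have := hμ.compl a
  have := hμ.nonneg aᶜ
  linarith

theorem compl_inf_congr {a b c : B} (h : a ⊓ c = b ⊓ c) : aᶜ ⊓ c = bᶜ ⊓ c := by
  rw [inf_comm, inf_comm _ c, ← sdiff_eq, ← sdiff_eq, ← sdiff_inf_self_right,
    ← sdiff_inf_self_right b c, h]

/-- A symmetric relation whose sections are Boolean subalgebras of `μ`-independent elements. -/
structure IsIndepRel (μ : B → ℝ) (R : B → B → Prop) : Prop where
  symm : ∀ a b, R a b → R b a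
  bot : ∀ a, R a ⊥
  compl : ∀ a b, R a b → R a bᶜ
  sup : ∀ a b c, R a b → R a c → R a (b ⊔ c)
  indep : ∀ a b, R a b → μ (a ⊓ b) = μ a * μ b

namespace IsIndepRel

variable {R : B → B → Prop}

theorem top (hR : IsIndepRel μ R) (a : B) : R a ⊤ := by
  simpa using hR.compl _ _ (hR.bot a)

theorem inf (hR : IsIndepRel μ R) {a b c : B} (hb : R a b) (hc : R a c) : R a (b ⊓ c) := by
  simpa using hR.compl _ _ (hR.sup _ _ _ (hR.compl _ _ hb) (hR.compl _ _ hc))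

theorem himp (hR : IsIndepRel μ R) {a b c : B} (hb : R a b) (hc : R a c) : R a (b ⇨ c) := by
  rw [_root_.himp_eq]
  exact hR.sup _ _ _ hc (hR.compl _ _ hb)

theorem compl_left (hR : IsIndepRel μ R) {a b : B} (h : R a b) : R aᶜ b :=
  hR.symm _ _ (hR.compl _ _ (hR.symm _ _ h))

/-- An element related to `φ` is determined by its trace on `φ`. -/
theorem eq_of_inf_eq (hR : IsIndepRel μ R) (hpos : ∀ a, μ a = 0 → a = ⊥) (h0 : μ ⊥ = 0)
    {φ a b : B} (hφ : φ ≠ ⊥) (ha : R φ a) (hb : R φ b) (h : a ⊓ φ = b ⊓ φ) : a = b := by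
  have key : ∀ x y, R φ x → R φ y → x ⊓ φ = y ⊓ φ → x ≤ y := by
    intro x y hx hy hxy
    -- The difference `x ⊓ yᶜ` is independent of `φ` and disjoint from it, so the product of the two
    -- measures is zero.
    have h₁ := hR.indep _ _ (hR.inf hx (hR.compl _ _ hy))
    have h₂ : φ ⊓ (x ⊓ yᶜ) = ⊥ := by
      rw [← inf_assoc, inf_comm φ, hxy, inf_right_comm, inf_compl_eq_bot, bot_inf_eq]
    rw [h₂, h0, eq_comm, mul_eq_zero] at h₁
    rcases h₁ with h₁ | h₁
    · exact absurd (hpos _ h₁) hφ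
    · exact disjoint_compl_right_iff.1 (disjoint_iff.2 (hpos _ h₁))
  exact le_antisymm (key _ _ ha hb h) (key _ _ hb ha h.symm)

/-- A saturated independence relation yields a conditioning operation. -/
theorem exists_isConditioning (hR : IsIndepRel μ R) (hpos : ∀ a, μ a = 0 → a = ⊥)
    (h0 : μ ⊥ = 0) (hex : ∀ φ, φ ≠ ⊥ → ∀ ψ, ∃ χ, R φ χ ∧ χ ⊓ φ = ψ ⊓ φ) :
    ∃ h : B → B → B, IsConditioning h ∧ ∀ φ ψ, h φ ψ = ψ ↔ R φ ψ := by
  classical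
  choose! g hgR hg using hex
  have uniq : ∀ {φ a b : B}, φ ≠ ⊥ → R φ a → R φ b → a ⊓ φ = b ⊓ φ → a = b :=
    fun hφ ha hb => hR.eq_of_inf_eq hpos h0 hφ ha hb
  -- At `⊥` every element must be fixed, since `R ⊥ ψ` always holds; the identity does this and is
  -- still compatible with complements and implications.
  let h : B → B → B := fun φ ψ => if φ = ⊥ then ψ else g φ ψ
  have hbot : ∀ ψ, h ⊥ ψ = ψ := fun ψ => if_pos rfl
  have hne : ∀ φ ψ, φ ≠ ⊥ → h φ ψ = g φ ψ := fun φ ψ hφ => if_neg hφ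
  have hfix : ∀ φ ψ, h φ ψ = ψ ↔ R φ ψ := by
    intro φ ψ
    by_cases hφ : φ = ⊥
    · subst hφ
      exact ⟨fun _ => hR.symm _ _ (hR.bot _), fun _ => hbot _⟩
    · rw [hne _ _ hφ]
      exact ⟨fun e => e ▸ hgR φ hφ ψ, fun hr => uniq hφ (hgR φ hφ ψ) hr (hg φ hφ ψ)⟩
  have hcompl : ∀ φ ψ, h φ ψᶜ = (h φ ψ)ᶜ := by
    intro φ ψ
    by_cases hφ : φ = ⊥
    · subst hφ; simp only [hbot]
    · simp only [hne _ _ hφ]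
      refine uniq hφ (hgR φ hφ _) (hR.compl _ _ (hgR φ hφ _)) ?_
      rw [hg φ hφ, compl_inf_congr (hg φ hφ ψ)]
  refine ⟨h, ⟨?_, ?_, ?_, hcompl, ?_⟩, hfix⟩
  · intro φ ψ hφ hle
    rw [hne _ _ hφ]
    refine uniq hφ (hgR φ hφ _) (hR.top φ) ?_
    rw [hg φ hφ, top_inf_eq, inf_eq_right.2 hle]
  · intro φ ψ η
    by_cases hφ : φ = ⊥
    · subst hφ; simp only [hbot, le_refl]
    · simp only [hne _ _ hφ]
      refine le_of_eq (uniq hφ (hgR φ hφ _) (hR.himp (hgR φ hφ _) (hgR φ hφ _)) ?_)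
      rw [hg φ hφ, _root_.himp_eq, _root_.himp_eq, inf_sup_right, inf_sup_right, hg φ hφ,
        compl_inf_congr (hg φ hφ ψ)]
  · intro φ ψ
    by_cases hφ : φ = ⊥
    · subst hφ; simp
    · rw [hne _ _ hφ, hg φ hφ]
      exact inf_le_left
  · intro φ ψ
    rw [hfix, hfix]
    exact ⟨hR.symm _ _, hR.symm _ _⟩

end IsIndepRel

end Charge

/-! ### Periodic sets and their density -/

open Function Set

/-- The Boolean algebra of periodic sets of natural numbers. -/
def periodicSets : BooleanSubalgebra (Set ℕ) where
  carrier := {S | ∃ N, 0 < N ∧ Periodic (· ∈ S) N}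
  supClosed' := by
    rintro S ⟨N, hN, hS⟩ T ⟨M, hM, hT⟩
    refine ⟨N * M, Nat.mul_pos hN hM, fun x => ?_⟩
    have h₁ := hS.nat_mul M x
    have h₂ := hT.nat_mul N x
    simp only [Nat.cast_id] at h₁ h₂
    rw [mul_comm] at h₁
    simp only [sup_eq_union, mem_union, h₁, h₂]
  infClosed' := by
    rintro S ⟨N, hN, hS⟩ T ⟨M, hM, hT⟩
    refine ⟨N * M, Nat.mul_pos hN hM, fun x => ?_⟩
    have h₁ := hS.nat_mul M x
    have h₂ := hT.nat_mul N x
    simp only [Nat.cast_id] at h₁ h₂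
    rw [mul_comm] at h₁
    simp only [inf_eq_inter, mem_inter_iff, h₁, h₂]
  compl_mem' := by
    rintro S ⟨N, hN, hS⟩
    exact ⟨N, hN, fun x => congrArg Not (hS x)⟩
  bot_mem' := ⟨1, one_pos, fun _ => rfl⟩

/-- `N` is a period of the periodic set `a`. -/
def HasPeriod (N : ℕ) (a : periodicSets) : Prop := Periodic (· ∈ (a : Set ℕ)) N

namespace HasPeriod

variable {N : ℕ} {a b : periodicSets}

theorem mul_right (h : HasPeriod N a) (M : ℕ) : HasPeriod (N * M) a := by
  have := h.nat_mul M
  rwa [Nat.cast_id, mul_comm] at this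

theorem mul_left (h : HasPeriod N a) (M : ℕ) : HasPeriod (M * N) a := h.nat_mul M

theorem sup (ha : HasPeriod N a) (hb : HasPeriod N b) : HasPeriod N (a ⊔ b) :=
  fun x => congrArg₂ Or (ha x) (hb x)

theorem inf (ha : HasPeriod N a) (hb : HasPeriod N b) : HasPeriod N (a ⊓ b) :=
  fun x => congrArg₂ And (ha x) (hb x)

theorem compl (ha : HasPeriod N a) : HasPeriod N aᶜ := fun x => congrArg Not (ha x)

theorem bot : HasPeriod N ⊥ := fun _ => rfl

theorem top : HasPeriod N ⊤ := fun _ => rfl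

theorem mem_mod_iff (ha : HasPeriod N a) (x : ℕ) : x % N ∈ (a : Set ℕ) ↔ x ∈ (a : Set ℕ) :=
  iff_of_eq (ha.map_mod_nat x)

theorem mem_add_mul_iff (ha : HasPeriod N a) (x z : ℕ) :
    x + N * z ∈ (a : Set ℕ) ↔ x ∈ (a : Set ℕ) :=
  iff_of_eq (ha.mul_right z x)

end HasPeriod

theorem exists_hasPeriod (a : periodicSets) : ∃ N, 0 < N ∧ HasPeriod N a := a.2

theorem exists_common_hasPeriod (a b : periodicSets) :
    ∃ N, 0 < N ∧ HasPeriod N a ∧ HasPeriod N b := by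
  obtain ⟨N, hN, ha⟩ := exists_hasPeriod a
  obtain ⟨M, hM, hb⟩ := exists_hasPeriod b
  exact ⟨N * M, Nat.mul_pos hN hM, ha.mul_right M, hb.mul_left N⟩

/-- The number of elements of `S` below `N`. -/
noncomputable def countBelow (N : ℕ) (S : Set ℕ) : ℝ :=
  ∑ x ∈ Finset.range N, S.indicator (1 : ℕ → ℝ) x

theorem indicator_one_congr {x y : ℕ} {S T : Set ℕ} (h : x ∈ S ↔ y ∈ T) :
    S.indicator (1 : ℕ → ℝ) x = T.indicator 1 y := by
  by_cases hy : y ∈ T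
  · rw [indicator_of_mem (h.2 hy), indicator_of_mem hy, Pi.one_apply, Pi.one_apply]
  · rw [indicator_of_notMem (mt h.1 hy), indicator_of_notMem hy]

open Classical in
theorem countBelow_eq_card (N : ℕ) (S : Set ℕ) :
    countBelow N S = ((Finset.range N).filter (· ∈ S)).card := by
  rw [Finset.card_filter, Nat.cast_sum]
  refine Finset.sum_congr rfl fun x _ => ?_
  by_cases h : x ∈ S <;> simp [h]

theorem countBelow_nonneg (N : ℕ) (S : Set ℕ) : 0 ≤ countBelow N S :=
  Finset.sum_nonneg fun _ _ => indicator_nonneg (fun _ _ => zero_le_one) _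

theorem countBelow_pos {N x : ℕ} {S : Set ℕ} (hx : x < N) (h : x ∈ S) : 0 < countBelow N S := by
  refine Finset.sum_pos' (fun _ _ => indicator_nonneg (fun _ _ => zero_le_one) _)
    ⟨x, Finset.mem_range.2 hx, ?_⟩
  simp [h]

theorem sum_range_mul (f : ℕ → ℝ) (N M : ℕ) :
    ∑ x ∈ Finset.range (N * M), f x =
      ∑ z ∈ Finset.range M, ∑ y ∈ Finset.range N, f (y + N * z) := by
  induction M with
  | zero => simp
  | succ M ih =>
    rw [Nat.mul_succ, Finset.sum_range_add, ih, Finset.sum_range_succ]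
    simp only [add_comm]

theorem HasPeriod.countBelow_mul {N : ℕ} {a : periodicSets} (h : HasPeriod N a) (M : ℕ) :
    countBelow (N * M) a = M * countBelow N a := by
  unfold countBelow
  rw [sum_range_mul]
  have : ∀ z y, (a : Set ℕ).indicator (1 : ℕ → ℝ) (y + N * z) = (a : Set ℕ).indicator 1 y := by
    intro z y
    exact indicator_one_congr (h.mem_add_mul_iff y z)
  simp only [this, Finset.sum_const, Finset.card_range, nsmul_eq_mul]

/-- The asymptotic density of a periodic set. -/
noncomputable def density (a : periodicSets) : ℝ :=
  countBelow (exists_hasPeriod a).choose a / (exists_hasPeriod a).choose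

/-- The period chosen in `density` is immaterial: two periods are compared by counting up to their
product. -/
theorem HasPeriod.density_eq {N : ℕ} {a : periodicSets} (hN : 0 < N) (h : HasPeriod N a) :
    density a = countBelow N a / N := by
  obtain ⟨hM, h'⟩ := (exists_hasPeriod a).choose_spec
  unfold density
  generalize (exists_hasPeriod a).choose = M at *
  have h₁ := h.countBelow_mul M
  rw [mul_comm, h'.countBelow_mul] at h₁
  field_simp
  linarith

theorem HasPeriod.countBelow_eq {N : ℕ} {a : periodicSets} (hN : 0 < N) (h : HasPeriod N a) :
    countBelow N a = N * density a := by
  rw [h.density_eq hN]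
  field_simp

theorem isCharge_density : IsCharge density where
  nonneg a := div_nonneg (countBelow_nonneg _ _) (Nat.cast_nonneg _)
  inf_add_sup a b := by
    obtain ⟨N, hN, ha, hb⟩ := exists_common_hasPeriod a b
    rw [ha.density_eq hN, hb.density_eq hN, (ha.inf hb).density_eq hN, (ha.sup hb).density_eq hN,
      ← add_div, ← add_div]
    unfold countBelow
    rw [← Finset.sum_add_distrib, ← Finset.sum_add_distrib]
    congr 1
    refine Finset.sum_congr rfl fun x _ => ?_
    rw [add_comm]
    exact indicator_union_add_inter_apply _ _ _ _
  bot := by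
    rw [HasPeriod.bot.density_eq one_pos]
    simp [countBelow]
  top := by
    rw [HasPeriod.top.density_eq one_pos]
    simp [countBelow]

theorem eq_bot_of_density_eq_zero (a : periodicSets) (h : density a = 0) : a = ⊥ := by
  obtain ⟨N, hN, ha⟩ := exists_hasPeriod a
  refine Subtype.ext (eq_empty_of_forall_notMem fun x hx => ?_)
  have := countBelow_pos (Nat.mod_lt x hN) ((ha.mem_mod_iff x).2 hx)
  rw [ha.countBelow_eq hN, h, mul_zero] at this
  exact lt_irrefl _ this

instance : Countable periodicSets := by
  classical
  refine Function.Injective.countable (β := ℕ × Finset ℕ) (f := fun a =>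
    ⟨(exists_hasPeriod a).choose,
      (Finset.range (exists_hasPeriod a).choose).filter (· ∈ (a : Set ℕ))⟩) ?_
  intro a b hab
  simp only [Prod.mk.injEq] at hab
  obtain ⟨hN, ha⟩ := (exists_hasPeriod a).choose_spec
  obtain ⟨hM, hb⟩ := (exists_hasPeriod b).choose_spec
  generalize (exists_hasPeriod a).choose = N at *
  generalize (exists_hasPeriod b).choose = M at *
  obtain ⟨rfl, h⟩ := hab
  ext x
  have := Finset.ext_iff.1 h (x % N)
  simp only [Finset.mem_filter, Finset.mem_range, Nat.mod_lt x hN, true_and, ha.mem_mod_iff,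
    hb.mem_mod_iff] at this
  exact this

/-- `{x | (x / N) % M < s x}` is an event whose digit `(x / N) % M` is independent of `x % N`. -/
theorem countBelow_inter_digit {N M : ℕ} {a : periodicSets} (ha : HasPeriod N a)
    {s : ℕ → ℕ} (hs : Periodic s N) (hsM : ∀ x, s x ≤ M) :
    countBelow (N * M) (a ∩ {x | (x / N) % M < s x}) =
      ∑ y ∈ Finset.range N, (a : Set ℕ).indicator 1 y * (s y : ℝ) := by
  classical
  unfold countBelow
  rw [sum_range_mul, Finset.sum_comm]
  refine Finset.sum_congr rfl fun y hy => ?_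
  rw [Finset.mem_range] at hy
  have h₁ : ∀ z ∈ Finset.range M,
      ((a : Set ℕ) ∩ {x | (x / N) % M < s x}).indicator (1 : ℕ → ℝ) (y + N * z) =
        (a : Set ℕ).indicator 1 y * if z < s y then 1 else 0 := by
    intro z hz
    rw [Finset.mem_range] at hz
    have e₁ : (y + N * z) / N % M = z := by
      rw [Nat.add_mul_div_left _ _ (by omega), Nat.div_eq_of_lt hy, zero_add, Nat.mod_eq_of_lt hz]
    have e₂ : s (y + N * z) = s y := by
      have := hs.nat_mul z y
      rwa [Nat.cast_id, mul_comm] at this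
    simp only [indicator, mem_inter_iff, ha.mem_add_mul_iff, mem_ofPred_eq, e₁, e₂]
    by_cases y ∈ (a : Set ℕ) <;> by_cases z < s y <;> simp [*]
  rw [Finset.sum_congr rfl h₁, ← Finset.mul_sum]
  congr 1
  have h₂ : (Finset.range M).filter (· < s y) = Finset.range (s y) := by
    ext z
    have := hsM y
    simp only [Finset.mem_filter, Finset.mem_range]
    omega
  rw [Finset.sum_ite, h₂]
  simp

/-! ### Cells of an algebra of bounded period, and the construction of one conditional event -/

/-- The points which the algebra `A` does not separate from `y`. -/
def cell (A : BooleanSubalgebra periodicSets) (y : ℕ) : Set ℕ :=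
  {x | ∀ a ∈ A, x ∈ (a : Set ℕ) ↔ y ∈ (a : Set ℕ)}

section Cell

variable {A : BooleanSubalgebra periodicSets} {N : ℕ}

theorem mem_cell_self (y : ℕ) : y ∈ cell A y := fun _ _ => Iff.rfl

theorem mem_cell_comm {x y : ℕ} : x ∈ cell A y ↔ y ∈ cell A x :=
  ⟨fun h a ha => (h a ha).symm, fun h a ha => (h a ha).symm⟩

theorem cell_eq_of_mem {x y : ℕ} (h : x ∈ cell A y) : cell A x = cell A y :=
  Set.ext fun _ => forall₂_congr fun a ha => by rw [h a ha]

theorem mod_mem_cell (hA : ∀ a ∈ A, HasPeriod N a) (x : ℕ) : x % N ∈ cell A x :=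
  fun a ha => (hA a ha).mem_mod_iff x

theorem add_mem_cell (hA : ∀ a ∈ A, HasPeriod N a) (x : ℕ) : x + N ∈ cell A x :=
  fun a ha => iff_of_eq (hA a ha x)

theorem exists_mem_biUnion {ι : Type*} (s : Finset ι) (f : ι → periodicSets)
    (hf : ∀ i ∈ s, f i ∈ A) : ∃ c ∈ A, ∀ x, x ∈ (c : Set ℕ) ↔ ∃ i ∈ s, x ∈ (f i : Set ℕ) := by
  classical
  induction s using Finset.induction_on with
  | empty => exact ⟨⊥, A.bot_mem, fun x => by simp⟩
  | insert i s _ ih =>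
    obtain ⟨c, hc, hcs⟩ := ih fun j hj => hf j (Finset.mem_insert_of_mem hj)
    refine ⟨f i ⊔ c, A.sup_mem (hf i (Finset.mem_insert_self _ _)) hc, fun x => ?_⟩
    rw [Finset.exists_mem_insert, ← hcs]
    exact Iff.rfl

/-- Each residue outside the cell is separated from `y` by an element of `A` that misses `y`. The
common period leaves only `N` residues to exclude, so a finite union of such elements is the
complement of the cell. -/
theorem exists_mem_eq_cell (hN : 0 < N) (hA : ∀ a ∈ A, HasPeriod N a) (y : ℕ) :
    ∃ c ∈ A, (c : Set ℕ) = cell A y := by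
  have h : ∀ x, ∃ b ∈ A, y ∉ (b : Set ℕ) ∧ (x ∉ (b : Set ℕ) → x ∈ cell A y) := by
    intro x
    by_cases hx : x ∈ cell A y
    · exact ⟨⊥, A.bot_mem, fun h => h, fun _ => hx⟩
    · simp only [cell, mem_ofPred_eq, not_forall] at hx
      obtain ⟨a, ha, hne⟩ := hx
      by_cases hy : y ∈ (a : Set ℕ)
      · exact ⟨aᶜ, A.compl_mem ha, fun h => h hy, fun h => absurd (not_not.1 h) (by tauto)⟩
      · exact ⟨a, ha, hy, fun h => absurd h (by tauto)⟩
  choose b hbA hyb hb using h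
  obtain ⟨c, hc, hcb⟩ := exists_mem_biUnion (A := A) (Finset.range N) b fun i _ => hbA i
  refine ⟨cᶜ, A.compl_mem hc, Set.ext fun x => ?_⟩
  have hy : y ∉ (c : Set ℕ) := fun h => by
    obtain ⟨i, _, hi⟩ := (hcb y).1 h
    exact hyb i hi
  constructor
  · intro hx
    have hx' : x % N ∉ (c : Set ℕ) := fun h => hx (((hA c hc).mem_mod_iff x).1 h)
    have := hb (x % N) fun h => hx' ((hcb _).2 ⟨_, Finset.mem_range.2 (Nat.mod_lt x hN), h⟩)
    rw [← cell_eq_of_mem this]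
    exact mem_cell_comm.1 (mod_mem_cell hA x)
  · intro hx h
    exact hy ((hx c hc).1 h)

/-- A saturated set is the union of the cells of its points, and finitely many cells suffice, those
of its residues below `N`. -/
theorem mem_of_saturated (hN : 0 < N) (hA : ∀ a ∈ A, HasPeriod N a) {S : periodicSets}
    (hS : ∀ x y, x ∈ cell A y → y ∈ (S : Set ℕ) → x ∈ (S : Set ℕ)) : S ∈ A := by
  classical
  choose c hcA hc using exists_mem_eq_cell hN hA
  obtain ⟨d, hd, hdc⟩ := exists_mem_biUnion (A := A)
    ((Finset.range N).filter (· ∈ (S : Set ℕ))) c fun i _ => hcA i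
  have : d = S := by
    ext x
    rw [hdc]
    constructor
    · rintro ⟨i, hi, hx⟩
      rw [hc] at hx
      exact hS x i hx (Finset.mem_filter.1 hi).2
    · intro hx
      have hm := mod_mem_cell hA x
      refine ⟨x % N, Finset.mem_filter.2 ⟨Finset.mem_range.2 (Nat.mod_lt x hN), hS _ _ hm hx⟩, ?_⟩
      rw [hc]
      exact mem_cell_comm.1 hm
  exact this ▸ hd

end Cell

-- The event `χ` agrees with `ψ` on `φ`. On `φᶜ` it is cut out by the digit `(x / N) % M`, with a
-- threshold giving `χ` in each cell of `A` the same proportion of `φᶜ` as `ψ` has of `φ`; this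
-- makes `φ` independent of `χ` relative to `A`.
--
-- The last clause is the freshness of `χ`: in a cell where the threshold is strictly between `0`
-- and `M`, the digit destroys period `N`, and in the other cells `χ` is all or nothing. Hence
-- adjoining `χ` to `A` creates no new set of period `N`.
set_option maxHeartbeats 1000000 in
theorem exists_conditional_of_indep {A : BooleanSubalgebra periodicSets} {N : ℕ} (hN : 0 < N)
    (hA : ∀ a ∈ A, HasPeriod N a) {φ ψ : periodicSets} (hφ : HasPeriod N φ) (hψ : HasPeriod N ψ)
    (hind : ∀ a ∈ A, density (φ ⊓ a) = density φ * density a) (h0 : φ ≠ ⊥) (h1 : φ ≠ ⊤) :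
    ∃ χ : periodicSets, χ ⊓ φ = ψ ⊓ φ ∧
      (∀ a ∈ A, density (φ ⊓ (a ⊓ χ)) = density φ * density (a ⊓ χ)) ∧
      ∀ a ∈ A, ∀ b ∈ A, HasPeriod N (a ⊓ χ ⊔ b ⊓ χᶜ) → a ⊓ χ ⊔ b ⊓ χᶜ ∈ A := by
  classical
  have hp0 : 0 < density φ := (isCharge_density.nonneg φ).lt_of_ne'
    fun h => h0 (eq_bot_of_density_eq_zero φ h)
  have hp1 : 0 < 1 - density φ := by
    rw [← isCharge_density.compl]
    exact (isCharge_density.nonneg φᶜ).lt_of_ne'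
      fun h => h1 (compl_eq_bot.1 (eq_bot_of_density_eq_zero _ h))
  set p := density φ with hp
  have hNR : (0 : ℝ) < N := Nat.cast_pos.2 hN
  choose c hcA hc using exists_mem_eq_cell hN hA
  -- numbers of points of `φ`, `φᶜ` and `φ ⊓ ψ` in a cell
  set n : ℕ → ℝ := fun y => countBelow N (φ ⊓ c y : periodicSets) with hn
  set m : ℕ → ℝ := fun y => countBelow N (φᶜ ⊓ c y : periodicSets) with hm
  set k : ℕ → ℝ := fun y => countBelow N (ψ ⊓ φ ⊓ c y : periodicSets) with hk
  have hcc : ∀ {x y}, x ∈ cell A y → c x = c y := fun {x y} h =>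
    Subtype.ext (by rw [hc, hc, cell_eq_of_mem h])
  have hself : ∀ y, y ∈ (c y : Set ℕ) := fun y => (hc y).symm ▸ mem_cell_self y
  have hpos : ∀ y, 0 < density (c y) := by
    intro y
    refine (isCharge_density.nonneg _).lt_of_ne' fun h => ?_
    have := hself y
    rw [eq_bot_of_density_eq_zero _ h] at this
    exact this
  have hnval : ∀ y, n y = N * (p * density (c y)) := fun y => by
    rw [hn]; dsimp only
    rw [(hφ.inf (hA _ (hcA y))).countBelow_eq hN, hind _ (hcA y)]
  have hmval : ∀ y, m y = N * ((1 - p) * density (c y)) := fun y => by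
    have := isCharge_density.inf_add_inf_compl (c y) φ
    rw [inf_comm, hind _ (hcA y), inf_comm] at this
    rw [hm]; dsimp only
    rw [(hφ.compl.inf (hA _ (hcA y))).countBelow_eq hN]
    congr 1
    linarith
  have hnpos : ∀ y, 0 < n y := fun y => by rw [hnval]; have := hpos y; positivity
  have hmpos : ∀ y, 0 < m y := fun y => by rw [hmval]; have := hpos y; positivity
  have hpm : ∀ y, p * m y = (1 - p) * n y := fun y => by rw [hnval, hmval]; ring
  -- the threshold, proportional to the conditional probability of `ψ` in the trace of the cell
  have hs' : ∀ C : periodicSets, 0 < countBelow N (φ ⊓ C : periodicSets) → ∃ s : ℕ,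
      (s : ℝ) = countBelow N (ψ ⊓ φ ⊓ C : periodicSets) / countBelow N (φ ⊓ C : periodicSets)
        * (N.factorial : ℕ) := by
    intro C hC
    rw [countBelow_eq_card] at hC ⊢
    rw [countBelow_eq_card]
    -- The denominator is an integer between `1` and `N`, so the factor `N!` makes every threshold
    -- an integer.
    obtain ⟨q, hq⟩ := Nat.dvd_factorial (Nat.cast_pos.1 hC)
      ((Finset.card_filter_le _ _).trans (Finset.card_range N).le)
    refine ⟨((Finset.range N).filter (· ∈ ((ψ ⊓ φ ⊓ C : periodicSets) : Set ℕ))).card * q, ?_⟩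
    rw [hq, Nat.cast_mul, Nat.cast_mul]
    field_simp
  -- The choice depends on the set `C`, not on a point, so the threshold is constant on cells.
  choose! σ hσ using hs'
  set M := N.factorial with hM
  have hM0 : 0 < M := N.factorial_pos
  have hMR : (0 : ℝ) < M := Nat.cast_pos.2 hM0
  set s : ℕ → ℕ := fun y => σ (c y) with hsdef
  have hs : ∀ y, (s y : ℝ) = k y / n y * M := fun y => hσ _ (hnpos y)
  have hscell : ∀ {x y}, x ∈ cell A y → s x = s y := fun h => by
    simp only [hsdef, hcc h]
  have hsper : Periodic s N := fun x => hscell (add_mem_cell hA x)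
  have hmono : ∀ {S T : Set ℕ}, S ⊆ T → countBelow N S ≤ countBelow N T := fun h =>
    Finset.sum_le_sum fun x _ => indicator_le_indicator_of_subset h (fun _ => zero_le_one) x
  have hkn : ∀ y, k y ≤ n y := fun y => hmono fun x hx => ⟨hx.1.2, hx.2⟩
  have hsM : ∀ y, s y ≤ M := fun y => by
    rw [← Nat.cast_le (α := ℝ), hs]
    exact mul_le_of_le_one_left hMR.le ((div_le_one (hnpos y)).2 (hkn y))
  -- extreme values of the threshold
  have hperc : ∀ y, HasPeriod N (c y) := fun y => hA _ (hcA y)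
  have hs_zero : ∀ y, s y = 0 → ∀ x ∈ cell A y, x ∈ (φ : Set ℕ) → x ∉ (ψ : Set ℕ) := by
    intro y hy x hx hxφ hxψ
    have : 0 < k y := countBelow_pos (Nat.mod_lt x hN)
      ((((hψ.inf hφ).inf (hperc y)).mem_mod_iff x).2 ⟨⟨hxψ, hxφ⟩, (hc y).symm ▸ hx⟩)
    have h₂ := hs y
    rw [hy, Nat.cast_zero] at h₂
    have := hnpos y
    have : 0 < k y / n y * M := by positivity
    linarith
  have hs_top : ∀ y, s y = M → ∀ x ∈ cell A y, x ∈ (φ : Set ℕ) → x ∈ (ψ : Set ℕ) := by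
    intro y hy x hx hxφ
    by_contra hxψ
    have h₁ : 0 < countBelow N (ψᶜ ⊓ φ ⊓ c y : periodicSets) := countBelow_pos (Nat.mod_lt x hN)
      ((((hψ.compl.inf hφ).inf (hperc y)).mem_mod_iff x).2 ⟨⟨hxψ, hxφ⟩, (hc y).symm ▸ hx⟩)
    have h₂ : k y + countBelow N (ψᶜ ⊓ φ ⊓ c y : periodicSets) = n y := by
      rw [hk, hn]; dsimp only
      rw [((hψ.inf hφ).inf (hperc y)).countBelow_eq hN,
        ((hψ.compl.inf hφ).inf (hperc y)).countBelow_eq hN, (hφ.inf (hperc y)).countBelow_eq hN,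
        ← mul_add, inf_assoc, inf_assoc, inf_comm ψ, inf_comm ψᶜ,
        isCharge_density.inf_add_inf_compl]
    have h₃ := hs y
    rw [hy, eq_comm, mul_eq_right₀ hMR.ne', div_eq_one_iff_eq (hnpos y).ne'] at h₃
    linarith
  -- the new event
  set D : Set ℕ := {x | (x / N) % M < s x} with hD
  have hDper : Periodic (· ∈ D) (N * M) := fun x => by
    have e₁ : s (x + N * M) = s x := by
      have := hsper.nat_mul M x
      rwa [Nat.cast_id, mul_comm] at this
    simp only [hD, mem_ofPred_eq, e₁, Nat.add_mul_div_left _ _ hN, Nat.add_mod_right]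
  obtain ⟨δ, hδ⟩ : ∃ δ : periodicSets, (δ : Set ℕ) = D :=
    ⟨⟨D, N * M, Nat.mul_pos hN hM0, hDper⟩, rfl⟩
  have hδper : HasPeriod (N * M) δ := by rw [HasPeriod, hδ]; exact hDper
  refine ⟨ψ ⊓ φ ⊔ δ ⊓ φᶜ, ?_, ?_, ?_⟩
  · rw [inf_sup_right, inf_assoc, inf_idem, inf_assoc, inf_comm φᶜ, inf_compl_eq_bot, inf_bot_eq,
      sup_bot_eq]
  · intro a ha
    have haN := hA a ha
    have e₁ : φ ⊓ (a ⊓ (ψ ⊓ φ ⊔ δ ⊓ φᶜ)) = a ⊓ φ ⊓ ψ := by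
      ext x
      change (_ ∧ _ ∧ (_ ∧ _ ∨ _ ∧ ¬ _)) ↔ ((_ ∧ _) ∧ _)
      tauto
    have e₂ : a ⊓ (ψ ⊓ φ ⊔ δ ⊓ φᶜ) = a ⊓ φ ⊓ ψ ⊔ a ⊓ φᶜ ⊓ δ := by
      ext x
      change (_ ∧ (_ ∧ _ ∨ _ ∧ ¬ _)) ↔ (((_ ∧ _) ∧ _) ∨ ((_ ∧ ¬ _) ∧ _))
      tauto
    have e₃ : a ⊓ φ ⊓ ψ ⊓ (a ⊓ φᶜ ⊓ δ) = ⊥ := by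
      ext x
      change (((_ ∧ _) ∧ _) ∧ ((_ ∧ ¬ _) ∧ _)) ↔ False
      tauto
    rw [e₁, e₂, isCharge_density.sup_of_inf_eq_bot e₃]
    -- double counting of the pairs of points in the same cell
    have key : p * ∑ y ∈ Finset.range N, ((a ⊓ φᶜ : periodicSets) : Set ℕ).indicator 1 y *
        (k y / n y) = (1 - p) * countBelow N (a ⊓ φ ⊓ ψ : periodicSets) := by
      have h₁ : ∀ x y, ((a ⊓ φᶜ : periodicSets) : Set ℕ).indicator (1 : ℕ → ℝ) y *
          (((ψ ⊓ φ ⊓ c y : periodicSets) : Set ℕ).indicator 1 x / n y) =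
          ((a ⊓ φ ⊓ ψ : periodicSets) : Set ℕ).indicator 1 x *
          (((φᶜ ⊓ c x : periodicSets) : Set ℕ).indicator 1 y / n x) := by
        intro x y
        have m₁ : y ∈ ((a ⊓ φᶜ : periodicSets) : Set ℕ) ↔
          y ∈ (a : Set ℕ) ∧ y ∉ (φ : Set ℕ) := Iff.rfl
        have m₂ : x ∈ ((ψ ⊓ φ ⊓ c y : periodicSets) : Set ℕ) ↔
          (x ∈ (ψ : Set ℕ) ∧ x ∈ (φ : Set ℕ)) ∧ x ∈ (c y : Set ℕ) := Iff.rfl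
        have m₃ : x ∈ ((a ⊓ φ ⊓ ψ : periodicSets) : Set ℕ) ↔
          (x ∈ (a : Set ℕ) ∧ x ∈ (φ : Set ℕ)) ∧ x ∈ (ψ : Set ℕ) := Iff.rfl
        have m₄ : y ∈ ((φᶜ ⊓ c x : periodicSets) : Set ℕ) ↔
          y ∉ (φ : Set ℕ) ∧ y ∈ (c x : Set ℕ) := Iff.rfl
        rw [hc] at m₂ m₄
        by_cases hxy : x ∈ cell A y
        · have e₁ : n x = n y := by simp only [hn, hcc hxy]
          have e₂ := hxy a ha
          have e₃ := mem_cell_comm.1 hxy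
          simp only [indicator, m₁, m₂, m₃, m₄, hxy, e₁, e₂, e₃, and_true, Pi.one_apply]
          by_cases y ∈ (a : Set ℕ) <;> by_cases y ∈ (φ : Set ℕ) <;>
            by_cases x ∈ (φ : Set ℕ) <;> by_cases x ∈ (ψ : Set ℕ) <;> simp [*]
        · have e₃ := mt mem_cell_comm.2 hxy
          rw [indicator_of_notMem (a := x) (s := ((ψ ⊓ φ ⊓ c y : periodicSets) : Set ℕ))
              (by rw [m₂]; tauto),
            indicator_of_notMem (a := y) (s := ((φᶜ ⊓ c x : periodicSets) : Set ℕ))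
              (by rw [m₄]; tauto), zero_div, zero_div, mul_zero, mul_zero]
      have h₂ : ∑ y ∈ Finset.range N, ((a ⊓ φᶜ : periodicSets) : Set ℕ).indicator 1 y *
          (k y / n y) = ∑ x ∈ Finset.range N,
            ((a ⊓ φ ⊓ ψ : periodicSets) : Set ℕ).indicator 1 x * (m x / n x) := by
        simp only [hk, hm, countBelow, Finset.sum_div, Finset.mul_sum]
        rw [Finset.sum_comm]
        exact Finset.sum_congr rfl fun x _ => Finset.sum_congr rfl fun y _ => h₁ x y
      rw [h₂, countBelow, Finset.mul_sum, Finset.mul_sum]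
      refine Finset.sum_congr rfl fun x _ => ?_
      have h₃ := (hnpos x).ne'
      rw [mul_left_comm, ← mul_div_assoc, hpm, mul_div_cancel_right₀ _ h₃, mul_comm]
    have h₁ := countBelow_inter_digit (haN.inf hφ.compl) hsper hsM
    have h₂ : countBelow (N * M) (a ⊓ φᶜ ⊓ δ : periodicSets) = (N * M : ℕ) * density (a ⊓ φᶜ ⊓ δ) :=
      (((haN.inf hφ.compl).mul_right M).inf hδper).countBelow_eq (Nat.mul_pos hN hM0)
    have h₃ : ((a ⊓ φᶜ ⊓ δ : periodicSets) : Set ℕ) = ((a ⊓ φᶜ : periodicSets) : Set ℕ) ∩ D := by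
      rw [← hδ]; rfl
    have h₄ : ∑ y ∈ Finset.range N, ((a ⊓ φᶜ : periodicSets) : Set ℕ).indicator 1 y * (s y : ℝ)
        = M * ∑ y ∈ Finset.range N, ((a ⊓ φᶜ : periodicSets) : Set ℕ).indicator 1 y *
          (k y / n y) := by
      rw [Finset.mul_sum]
      refine Finset.sum_congr rfl fun y _ => ?_
      rw [hs]; ring
    rw [h₃, h₁, h₄] at h₂
    rw [((haN.inf hφ).inf hψ).countBelow_eq hN] at key
    generalize ∑ y ∈ Finset.range N, ((a ⊓ φᶜ : periodicSets) : Set ℕ).indicator 1 y *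
          (k y / n y) = T at *
    have h₅ : T = N * density (a ⊓ φᶜ ⊓ δ) := by
      push_cast at h₂
      exact mul_left_cancel₀ hMR.ne' (by linarith)
    rw [h₅] at key
    have : p * density (a ⊓ φᶜ ⊓ δ) = (1 - p) * density (a ⊓ φ ⊓ ψ) :=
      mul_left_cancel₀ hNR.ne' (by linarith)
    linarith
  · intro a ha b hb hper
    refine mem_of_saturated hN hA fun x y hxy => ?_
    have hmem : ∀ z, z ∈ ((a ⊓ (ψ ⊓ φ ⊔ δ ⊓ φᶜ) ⊔ b ⊓ (ψ ⊓ φ ⊔ δ ⊓ φᶜ)ᶜ : periodicSets) : Set ℕ) ↔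
        (z ∈ (a : Set ℕ) ∧ ((z ∈ (ψ : Set ℕ) ∧ z ∈ (φ : Set ℕ)) ∨ (z ∈ D ∧ z ∉ (φ : Set ℕ)))) ∨
        (z ∈ (b : Set ℕ) ∧ ¬ ((z ∈ (ψ : Set ℕ) ∧ z ∈ (φ : Set ℕ)) ∨ (z ∈ D ∧ z ∉ (φ : Set ℕ)))) :=
      fun z => by rw [← hδ]; exact Iff.rfl
    have hxa := hxy a ha
    have hxb := hxy b hb
    by_cases hab : y ∈ (a : Set ℕ) ↔ y ∈ (b : Set ℕ)
    · rw [hmem, hmem, hxa, hxb, hab, ← and_or_left, ← and_or_left]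
      exact fun h => ⟨h.1, em _⟩
    -- Since `m y > 0`, the cell meets `φᶜ`, where membership in `χ` is governed by the digit.
    · obtain ⟨w, hwN, hwφ, hwy⟩ : ∃ w < N, w ∉ (φ : Set ℕ) ∧ w ∈ cell A y := by
        by_contra! hne
        refine (hmpos y).ne' (Finset.sum_eq_zero fun w hw => indicator_of_notMem ?_ _)
        rintro ⟨h₁, h₂⟩
        exact hne w (Finset.mem_range.1 hw) h₁ (hc y ▸ h₂)
      have hw := hscell hwy
      -- The points `w` and `w + N * (M - 1)` agree modulo `N` and carry the extreme digits `0` and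
      -- `M - 1`. Since `a` and `b` differ on the cell, period `N` puts both points in `D` or
      -- neither, so the threshold is `0` or `M`.
      have hwM : w + N * (M - 1) ∉ (φ : Set ℕ) := mt (hφ.mem_add_mul_iff w _).1 hwφ
      have hD₀ : w ∈ D ↔ 0 < s y := by
        simp only [hD, mem_ofPred_eq, Nat.div_eq_of_lt hwN, Nat.zero_mod, hw]
      have hD₁ : w + N * (M - 1) ∈ D ↔ M - 1 < s y := by
        have : s (w + N * (M - 1)) = s w := by
          have := hsper.nat_mul (M - 1) w
          rwa [Nat.cast_id, mul_comm] at this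
        simp only [hD, mem_ofPred_eq, Nat.add_mul_div_left _ _ hN, Nat.div_eq_of_lt hwN, zero_add,
          Nat.mod_eq_of_lt (Nat.sub_lt hM0 one_pos), this, hw]
      have hcmp := hper.mem_add_mul_iff w (M - 1)
      rw [hmem, hmem, hD₀, hD₁, (hA a ha).mem_add_mul_iff, (hA b hb).mem_add_mul_iff,
        hwy a ha, hwy b hb] at hcmp
      have hsy : s y = 0 ∨ s y = M := by
        have : 0 < s y ↔ M - 1 < s y := by
          simp only [hwφ, hwM, and_false, not_false_eq_true, and_true, false_or] at hcmp
          by_cases hya : y ∈ (a : Set ℕ) <;> by_cases hyb : y ∈ (b : Set ℕ) <;>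
            simp only [hya, hyb, not_true, iff_self, true_and, false_and, or_false, false_or] at hab hcmp
          · exact hcmp.symm
          · exact (not_iff_not.1 hcmp).symm
        have := hsM y
        omega
      -- With an extreme threshold, `χ` contains the whole cell or none of it, on both sides of `φ`.
      have hconst : ∀ z ∈ cell A y, ((z ∈ (ψ : Set ℕ) ∧ z ∈ (φ : Set ℕ)) ∨
          (z ∈ D ∧ z ∉ (φ : Set ℕ))) ↔ s y = M := by
        intro z hz
        have hDz : z ∈ D ↔ (z / N) % M < s y := by rw [← hscell hz]; exact Iff.rfl
        have hlt := Nat.mod_lt (z / N) hM0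
        by_cases hzφ : z ∈ (φ : Set ℕ)
        · simp only [hzφ, and_true, not_true, and_false, or_false]
          rcases hsy with h | h
          · exact iff_of_false (hs_zero y h z hz hzφ) (by omega)
          · exact iff_of_true (hs_top y h z hz hzφ) h
        · simp only [hzφ, and_false, not_false_eq_true, and_true, false_or, hDz]
          omega
      rw [hmem, hmem, hconst x hxy, hconst y (mem_cell_self y), hxa, hxb]
      exact id

/-! ### Extending independence relations -/

/-- The Boolean subalgebra of elements related to `a`. -/
def IsIndepRel.fiber {B : Type*} [BooleanAlgebra B] {μ : B → ℝ} {R : B → B → Prop}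
    (hR : IsIndepRel μ R) (a : B) : BooleanSubalgebra B where
  carrier := {b | R a b}
  supClosed' _ hb _ hc := hR.sup a _ _ hb hc
  infClosed' _ hb _ hc := hR.inf hb hc
  compl_mem' hb := hR.compl a _ hb
  bot_mem' := hR.bot a

/-- An independence relation between periodic sets, which is nontrivial only among the sets with
a given period. -/
def IsBoundedIndepRel (R : periodicSets → periodicSets → Prop) : Prop :=
  IsIndepRel density R ∧ ∃ N, 0 < N ∧
    ∀ a b, R a b → (a = ⊥ ∨ a = ⊤) ∨ (b = ⊥ ∨ b = ⊤) ∨ HasPeriod N a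

theorem compl_inf_sup_inf_compl (a b χ : periodicSets) :
    (a ⊓ χ ⊔ b ⊓ χᶜ)ᶜ = aᶜ ⊓ χ ⊔ bᶜ ⊓ χᶜ := by
  ext x
  change ¬ ((_ ∧ _) ∨ (_ ∧ ¬ _)) ↔ ((¬ _ ∧ _) ∨ (¬ _ ∧ ¬ _))
  tauto

theorem inf_sup_inf_compl_sup (a b c d χ : periodicSets) :
    (a ⊓ χ ⊔ b ⊓ χᶜ) ⊔ (c ⊓ χ ⊔ d ⊓ χᶜ) = (a ⊔ c) ⊓ χ ⊔ (b ⊔ d) ⊓ χᶜ := by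
  rw [sup_sup_sup_comm, ← inf_sup_right, ← inf_sup_right]

theorem isBoundedIndepRel_trivial :
    IsBoundedIndepRel fun a b => (a = ⊥ ∨ a = ⊤) ∨ (b = ⊥ ∨ b = ⊤) := by
  refine ⟨⟨fun a b h => h.symm, fun a => .inr (.inl rfl), ?_, ?_, ?_⟩, 1, one_pos, fun a b h => ?_⟩
  · rintro a b (h | rfl | rfl)
    · exact .inl h
    · exact .inr (.inr compl_bot)
    · exact .inr (.inl compl_top)
  · rintro a b c (h | rfl | rfl) (h' | rfl | rfl) <;> simp [*]
  · rintro a b ((rfl | rfl) | rfl | rfl) <;> simp [isCharge_density.bot, isCharge_density.top]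
  · rcases h with h | h
    · exact .inl h
    · exact .inr (.inl h)

/-- The fiber of `φ` is enlarged to the algebra `A'` generated by it and a fresh `χ`, and the new
pairs are symmetrized and closed under complement of `φ`. The other fibers must remain algebras. If
`x ∈ A'` was not yet related to `φ`, freshness says that `x` lacks period `N`; the bound on `R` then
makes its old fiber trivial, and the new one is `{⊥, ⊤, φ, φᶜ}`. -/
theorem IsBoundedIndepRel.exists_extension {R : periodicSets → periodicSets → Prop}
    (hR : IsBoundedIndepRel R) {φ : periodicSets} (h0 : φ ≠ ⊥) (ψ : periodicSets) :
    ∃ R', IsBoundedIndepRel R' ∧ R ≤ R' ∧ ∃ χ, R' φ χ ∧ χ ⊓ φ = ψ ⊓ φ := by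
  by_cases h1 : φ = ⊤
  · subst h1
    exact ⟨R, hR, le_rfl, ψ, hR.1.symm _ _ (hR.1.top _), rfl⟩
  obtain ⟨hI, N₀, hN₀, hper₀⟩ := hR
  obtain ⟨N₁, hN₁, hφ₁, hψ₁⟩ := exists_common_hasPeriod φ ψ
  obtain ⟨N, hN, hφ, hψ, hper⟩ : ∃ N, 0 < N ∧ HasPeriod N φ ∧ HasPeriod N ψ ∧
      ∀ a b, R a b → (a = ⊥ ∨ a = ⊤) ∨ (b = ⊥ ∨ b = ⊤) ∨ HasPeriod N a :=
    ⟨N₀ * N₁, Nat.mul_pos hN₀ hN₁, hφ₁.mul_left _, hψ₁.mul_left _,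
      fun a b h => (hper₀ a b h).imp_right (Or.imp_right fun h => h.mul_right _)⟩
  have hA : ∀ a ∈ hI.fiber φ, HasPeriod N a := by
    intro a ha
    rcases hper a φ (hI.symm _ _ ha) with (rfl | rfl) | h | h
    · exact HasPeriod.bot
    · exact HasPeriod.top
    · tauto
    · exact h
  obtain ⟨χ, hχ, hind, hfresh⟩ :=
    exists_conditional_of_indep hN hA hφ hψ (fun a ha => hI.indep φ a ha) h0 h1
  obtain ⟨K, hK, hχK⟩ := exists_hasPeriod χ
  -- the algebra generated by the fiber of `φ` and `χ`
  set A' : Set periodicSets := {ξ | ∃ a b, R φ a ∧ R φ b ∧ a ⊓ χ ⊔ b ⊓ χᶜ = ξ} with hA'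
  have hbot' : ⊥ ∈ A' := ⟨⊥, ⊥, hI.bot _, hI.bot _, by simp⟩
  have hcompl' : ∀ ξ ∈ A', ξᶜ ∈ A' := by
    rintro _ ⟨a, b, ha, hb, rfl⟩
    exact ⟨aᶜ, bᶜ, hI.compl _ _ ha, hI.compl _ _ hb, (compl_inf_sup_inf_compl a b χ).symm⟩
  have hsup' : ∀ ξ ∈ A', ∀ ζ ∈ A', ξ ⊔ ζ ∈ A' := by
    rintro _ ⟨a, b, ha, hb, rfl⟩ _ ⟨c, d, hc, hd, rfl⟩
    exact ⟨a ⊔ c, b ⊔ d, hI.sup _ _ _ ha hc, hI.sup _ _ _ hb hd,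
      (inf_sup_inf_compl_sup a b c d χ).symm⟩
  have hsub' : ∀ a, R φ a → a ∈ A' := fun a ha =>
    ⟨a, a, ha, ha, by rw [← inf_sup_left, sup_compl_eq_top, inf_top_eq]⟩
  have hχ' : χ ∈ A' := ⟨⊤, ⊥, hI.top _, hI.bot _, by simp⟩
  have hfresh' : ∀ ξ ∈ A', HasPeriod N ξ → R φ ξ := by
    rintro _ ⟨a, b, ha, hb, rfl⟩ h
    exact hfresh a ha b hb h
  have hper' : ∀ ξ ∈ A', HasPeriod (N * K) ξ := by
    rintro _ ⟨a, b, ha, hb, rfl⟩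
    have h := hχK.mul_left N
    exact (((hA a ha).mul_right K).inf h).sup (((hA b hb).mul_right K).inf h.compl)
  have hind' : ∀ ξ ∈ A', density (φ ⊓ ξ) = density φ * density ξ := by
    rintro _ ⟨a, b, ha, hb, rfl⟩
    have e : a ⊓ χ ⊓ (b ⊓ χᶜ) = ⊥ := by
      rw [inf_inf_inf_comm, inf_compl_eq_bot, inf_bot_eq]
    have e' : φ ⊓ (a ⊓ χ) ⊓ (φ ⊓ (b ⊓ χᶜ)) = ⊥ := by
      rw [inf_inf_inf_comm, e, inf_bot_eq]
    rw [inf_sup_left, isCharge_density.sup_of_inf_eq_bot e, isCharge_density.sup_of_inf_eq_bot e',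
      hind a ha, mul_add]
    congr 1
    have h₁ := isCharge_density.inf_add_inf_compl b χ
    have h₂ := isCharge_density.inf_add_inf_compl (φ ⊓ b) χ
    rw [inf_assoc, inf_assoc, hind b hb, hI.indep _ _ hb, ← h₁] at h₂
    linarith
  have hindc : ∀ ξ ∈ A', density (φᶜ ⊓ ξ) = density φᶜ * density ξ := by
    intro ξ hξ
    have h₁ := isCharge_density.inf_add_inf_compl ξ φ
    rw [inf_comm, hind' ξ hξ, inf_comm] at h₁
    rw [isCharge_density.compl]
    linarith
  -- An event independent of itself has density `0` or `1`. Thus the symmetrized pairs add nothing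
  -- to the fibers of `φ` and `φᶜ` beyond `A'`.
  have hnot : φ ∉ A' := by
    intro h
    have h₁ := hind' φ h
    rw [inf_idem, eq_comm, mul_eq_left₀ fun h => h0 (eq_bot_of_density_eq_zero _ h)] at h₁
    refine h1 (compl_eq_bot.1 (eq_bot_of_density_eq_zero _ ?_))
    rw [isCharge_density.compl, h₁, sub_self]
  have hnotc : φᶜ ∉ A' := fun h => hnot (compl_compl φ ▸ hcompl' _ h)
  have hRc : ∀ {a}, R φᶜ a ↔ R φ a := fun {a} =>
    ⟨fun h => compl_compl φ ▸ hI.compl_left h, fun h => hI.compl_left h⟩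
  set R' : periodicSets → periodicSets → Prop := fun x y =>
    R x y ∨ ((x = φ ∨ x = φᶜ) ∧ y ∈ A') ∨ ((y = φ ∨ y = φᶜ) ∧ x ∈ A') with hR'
  have hfib : ∀ x, x = φ ∨ x = φᶜ → ∀ y, R' x y ↔ y ∈ A' := by
    intro x hx y
    refine ⟨?_, fun h => .inr (.inl ⟨hx, h⟩)⟩
    rintro (h | h | h)
    · rcases hx with rfl | rfl
      · exact hsub' y h
      · exact hsub' y (hRc.1 h)
    · exact h.2
    · rcases hx with rfl | rfl
      · exact absurd h.2 hnot
      · exact absurd h.2 hnotc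
  have hfib_old : ∀ x, ¬ (x = φ ∨ x = φᶜ) → (x ∉ A' ∨ R φ x) → ∀ y, R' x y ↔ R x y := by
    intro x hx hx' y
    refine ⟨?_, fun h => .inl h⟩
    rintro (h | h | ⟨h, hm⟩)
    · exact h
    · exact absurd h.1 hx
    · have hφx : R φ x := hx'.resolve_left (not_not.2 hm)
      rcases h with rfl | rfl
      · exact hI.symm _ _ hφx
      · exact hI.symm _ _ (hRc.2 hφx)
  have hfib_new : ∀ x, ¬ (x = φ ∨ x = φᶜ) → x ∈ A' → ¬ R φ x → ∀ y, R' x y ↔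
      (y = ⊥ ∨ y = ⊤) ∨ (y = φ ∨ y = φᶜ) := by
    intro x hx hxA hxn y
    constructor
    · rintro (h | h | h)
      · rcases hper x y h with (rfl | rfl) | h' | h'
        · exact absurd (hI.bot _) hxn
        · exact absurd (hI.top _) hxn
        · exact .inl h'
        · exact absurd (hfresh' x hxA h') hxn
      · exact absurd h.1 hx
      · exact .inr h.1
    · rintro ((rfl | rfl) | h)
      · exact .inl (hI.bot _)
      · exact .inl (hI.top _)
      · exact .inr (.inr ⟨h, hxA⟩)
  refine ⟨R', ⟨⟨?_, fun a => .inl (hI.bot a), ?_, ?_, ?_⟩, N * K, Nat.mul_pos hN hK, ?_⟩,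
    fun a b h => .inl h, χ, .inr (.inl ⟨.inl rfl, hχ'⟩), hχ⟩
  · rintro a b (h | h | h)
    · exact .inl (hI.symm _ _ h)
    · exact .inr (.inr h)
    · exact .inr (.inl h)
  · intro x y
    by_cases hx : x = φ ∨ x = φᶜ
    · rw [hfib x hx, hfib x hx]
      exact hcompl' y
    · by_cases hx' : x ∉ A' ∨ R φ x
      · rw [hfib_old x hx hx', hfib_old x hx hx']
        exact hI.compl x y
      · push Not at hx'
        rw [hfib_new x hx hx'.1 hx'.2, hfib_new x hx hx'.1 hx'.2]
        rintro ((rfl | rfl) | rfl | rfl) <;> simp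
  · intro x y z
    by_cases hx : x = φ ∨ x = φᶜ
    · rw [hfib x hx, hfib x hx, hfib x hx]
      exact fun hy hz => hsup' y hy z hz
    · by_cases hx' : x ∉ A' ∨ R φ x
      · rw [hfib_old x hx hx', hfib_old x hx hx', hfib_old x hx hx']
        exact hI.sup x y z
      · push Not at hx'
        simp only [hfib_new x hx hx'.1 hx'.2]
        rintro ((rfl | rfl) | rfl | rfl) ((rfl | rfl) | rfl | rfl) <;> simp
  · rintro a b (h | ⟨rfl | rfl, h⟩ | ⟨rfl | rfl, h⟩)
    · exact hI.indep a b h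
    · exact hind' b h
    · exact hindc b h
    · rw [inf_comm, mul_comm, hind' a h]
    · rw [inf_comm, mul_comm, hindc a h]
  · rintro a b (h | ⟨rfl | rfl, h⟩ | h)
    · exact (hper a b h).imp_right (Or.imp_right fun h => h.mul_right _)
    · exact .inr (.inr (hφ.mul_right _))
    · exact .inr (.inr (hφ.mul_right _).compl)
    · exact .inr (.inr (hper' a h.2))

/-- A generic independence relation between periodic sets is saturated. -/
theorem exists_saturated_isIndepRel :
    ∃ R : periodicSets → periodicSets → Prop, IsIndepRel density R ∧
      ∀ φ, φ ≠ ⊥ → ∀ ψ, ∃ χ, R φ χ ∧ χ ⊓ φ = ψ ⊓ φ := by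
  -- The demands are indexed by pairs `(φ, ψ)`, hence countable, and each is met cofinally; an ideal
  -- meeting all of them exists. Its union is an independence relation by directedness, although it
  -- need not be bounded.
  obtain ⟨_⟩ := nonempty_encodable (periodicSets × periodicSets)
  let D : periodicSets × periodicSets → Order.Cofinal {R // IsBoundedIndepRel R} := fun p =>
    { carrier := {R | p.1 ≠ ⊥ → ∃ χ, R.1 p.1 χ ∧ χ ⊓ p.1 = p.2 ⊓ p.1}
      isCofinal := fun R => by
        by_cases h : p.1 = ⊥
        · exact ⟨R, fun h' => absurd h h', le_rfl⟩
        · obtain ⟨R', hR', hle, hχ⟩ := R.2.exists_extension h p.2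
          exact ⟨⟨R', hR'⟩, fun _ => hχ, hle⟩ }
  let I := Order.idealOfCofinals ⟨_, isBoundedIndepRel_trivial⟩ D
  refine ⟨fun a b => ∃ R ∈ I, R.1 a b, ⟨?_, ?_, ?_, ?_, ?_⟩, ?_⟩
  · rintro a b ⟨R, hR, h⟩
    exact ⟨R, hR, R.2.1.symm a b h⟩
  · exact fun a => ⟨_, Order.mem_idealOfCofinals _ D, .inr (.inl rfl)⟩
  · rintro a b ⟨R, hR, h⟩
    exact ⟨R, hR, R.2.1.compl a b h⟩
  · rintro a b c ⟨R, hR, h⟩ ⟨S, hS, h'⟩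
    obtain ⟨T, hT, hRT, hST⟩ := I.directed R hR S hS
    exact ⟨T, hT, T.2.1.sup a b c (hRT a b h) (hST a c h')⟩
  · rintro a b ⟨R, hR, h⟩
    exact R.2.1.indep a b h
  · intro φ hφ ψ
    obtain ⟨R, hRD, hR⟩ := Order.cofinal_meets_idealOfCofinals
      ⟨_, isBoundedIndepRel_trivial⟩ D (φ, ψ)
    obtain ⟨χ, h, h'⟩ := hRD hφ
    exact ⟨χ, ⟨R, hR, h⟩, h'⟩

theorem exists_isConditioning_density :
    ∃ h : periodicSets → periodicSets → periodicSets, IsConditioning h ∧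
      ∀ φ ψ, h φ ψ = ψ → density (φ ⊓ ψ) = density φ * density ψ := by
  obtain ⟨R, hR, hsat⟩ := exists_saturated_isIndepRel
  obtain ⟨h, hh, hfix⟩ := hR.exists_isConditioning eq_bot_of_density_eq_zero
    isCharge_density.bot hsat
  exact ⟨h, hh, fun φ ψ e => hR.indep φ ψ ((hfix φ ψ).1 e)⟩

/-! ### Completeness of classical logic -/

namespace CFormula

variable {Θ : Type*}

/-- Truth of a classical formula under a valuation of the atoms. -/
def Sat (v : Θ → Prop) : CFormula Θ → Prop
  | atom θ => v θ
  | neg φ => ¬ φ.Sat v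
  | imp φ ψ => φ.Sat v → ψ.Sat v

/-- Derivability in `C` from a set of hypotheses. -/
inductive Entails (Γ : Set (CFormula Θ)) : CFormula Θ → Prop
  | hyp {φ : CFormula Θ} : φ ∈ Γ → Entails Γ φ
  | thm {φ : CFormula Θ} : Provable φ → Entails Γ φ
  | mp {φ ψ : CFormula Θ} : Entails Γ φ → Entails Γ (φ.imp ψ) → Entails Γ ψ

namespace Entails

variable {Γ Δ : Set (CFormula Θ)} {φ ψ : CFormula Θ}

theorem mono (h : Γ ⊆ Δ) (hφ : Entails Γ φ) : Entails Δ φ := by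
  induction hφ with
  | hyp hm => exact .hyp (h hm)
  | thm hp => exact .thm hp
  | mp _ _ ih₁ ih₂ => exact .mp ih₁ ih₂

theorem provable (h : Entails ∅ φ) : Provable φ := by
  induction h with
  | hyp hm => exact hm.elim
  | thm hp => exact hp
  | mp _ _ ih₁ ih₂ => exact .modusPonens ih₁ ih₂

theorem const (h : Entails Γ ψ) (φ : CFormula Θ) : Entails Γ (φ.imp ψ) :=
  .mp h (.thm (.c1 _ _))

theorem imp_self (φ : CFormula Θ) : Entails Γ (φ.imp φ) :=
  .mp (.thm (.c1 φ φ)) (.mp (.thm (.c1 φ (φ.imp φ))) (.thm (.c2 _ _ _)))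

theorem deduction (h : Entails (insert φ Γ) ψ) : Entails Γ (φ.imp ψ) := by
  induction h with
  | hyp hm =>
    rcases hm with rfl | hm
    · exact imp_self _
    · exact (hyp hm).const _
  | thm hp => exact (thm hp).const _
  | mp _ _ ih₁ ih₂ => exact .mp ih₁ (.mp ih₂ (.thm (.c2 _ _ _)))

theorem of_neg_imp (h₁ : Entails Γ (φ.neg.imp ψ)) (h₂ : Entails Γ (φ.neg.imp ψ.neg)) :
    Entails Γ φ :=
  .mp h₁ (.mp h₂ (.thm (.c3 _ _)))

theorem explosion (h₁ : Entails Γ ψ) (h₂ : Entails Γ ψ.neg) (φ : CFormula Θ) : Entails Γ φ :=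
  of_neg_imp (h₁.const _) (h₂.const _)

theorem of_cases (h₁ : Entails Γ (ψ.imp φ)) (h₂ : Entails Γ (ψ.neg.imp φ)) : Entails Γ φ := by
  refine of_neg_imp (ψ := φ) (deduction ?_) (imp_self _)
  have hφ : Entails (insert φ.neg Γ) φ.neg := .hyp (mem_insert _ _)
  have hψ : Entails (insert φ.neg Γ) ψ :=
    of_neg_imp (h₂.mono (subset_insert _ _)) (hφ.const _)
  exact .mp hψ (h₁.mono (subset_insert _ _))

theorem exists_of_sUnion {c : Set (Set (CFormula Θ))} (hc : IsChain (· ⊆ ·) c)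
    (hne : c.Nonempty) (h : Entails (⋃₀ c) φ) : ∃ Γ ∈ c, Entails Γ φ := by
  induction h with
  | hyp hm =>
    obtain ⟨Γ, hΓ, hm⟩ := hm
    exact ⟨Γ, hΓ, .hyp hm⟩
  | thm hp =>
    obtain ⟨Γ, hΓ⟩ := hne
    exact ⟨Γ, hΓ, .thm hp⟩
  | mp _ _ ih₁ ih₂ =>
    obtain ⟨Γ, hΓ, h₁⟩ := ih₁
    obtain ⟨Δ, hΔ, h₂⟩ := ih₂
    rcases hc.total hΓ hΔ with h | h
    · exact ⟨Δ, hΔ, .mp (h₁.mono h) h₂⟩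
    · exact ⟨Γ, hΓ, .mp h₁ (h₂.mono h)⟩

end Entails

/-- Completeness of the classical calculus `C`. -/
theorem provable_of_forall_sat {φ : CFormula Θ} (h : ∀ v, φ.Sat v) : Provable φ := by
  by_contra hφ
  -- A set `Γ` maximal among those not entailing `φ` is deductively closed and decides every
  -- formula, so membership in it is a valuation, and one that refutes `φ`.
  obtain ⟨Γ, -, hΓ⟩ := zorn_subset_nonempty {Γ : Set (CFormula Θ) | ¬ Entails Γ φ}
    (fun c hcs hc hne => ⟨⋃₀ c, fun he => by
      obtain ⟨Γ, hΓ, h'⟩ := he.exists_of_sUnion hc hne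
      exact hcs hΓ h', fun s hs => subset_sUnion_of_mem hs⟩) ∅ (fun he => hφ he.provable)
  have hmax : ∀ ψ, ψ ∉ Γ → Entails Γ (ψ.imp φ) := fun ψ hψ => by
    by_contra hne
    exact hψ (hΓ.le_of_ge (y := insert ψ Γ) (fun he => hne he.deduction) (subset_insert _ _)
      (mem_insert _ _))
  have hclosed : ∀ ψ, Entails Γ ψ → ψ ∈ Γ := fun ψ hψ => by
    by_contra hne
    exact hΓ.prop (.mp hψ (hmax ψ hne))
  have hneg : ∀ ψ : CFormula Θ, ψ.neg ∈ Γ ↔ ψ ∉ Γ := fun ψ =>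
    ⟨fun h₁ h₂ => hΓ.prop (.explosion (.hyp h₂) (.hyp h₁) _), fun h₁ => by
      by_contra h₂
      exact hΓ.prop (.of_cases (hmax _ h₁) (hmax _ h₂))⟩
  have himp : ∀ ψ η : CFormula Θ, ψ.imp η ∈ Γ ↔ (ψ ∈ Γ → η ∈ Γ) := fun ψ η => by
    refine ⟨fun h₁ h₂ => hclosed _ (.mp (.hyp h₂) (.hyp h₁)), fun h₁ => hclosed _ ?_⟩
    by_cases h₂ : ψ ∈ Γ
    · exact .const (.hyp (h₁ h₂)) _
    · exact .deduction (.explosion (.hyp (mem_insert _ _))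
        (.hyp (mem_insert_of_mem _ ((hneg ψ).2 h₂))) _)
  have htruth : ∀ ψ : CFormula Θ, ψ.Sat (fun θ => atom θ ∈ Γ) ↔ ψ ∈ Γ := by
    intro ψ
    induction ψ with
    | atom θ => exact Iff.rfl
    | neg ψ ih => rw [hneg, ← ih]; exact Iff.rfl
    | imp ψ η ih₁ ih₂ => rw [himp, ← ih₁, ← ih₂]; exact Iff.rfl
  exact hΓ.prop (.hyp ((htruth φ).1 (h _)))

section Sat

variable {v : Θ → Prop} {φ ψ : CFormula Θ}

theorem sat_or : (φ.or ψ).Sat v ↔ φ.Sat v ∨ ψ.Sat v := by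
  simp only [CFormula.or, Sat]
  tauto

theorem sat_and : (φ.and ψ).Sat v ↔ φ.Sat v ∧ ψ.Sat v := by
  simp only [CFormula.and, CFormula.or, Sat]
  tauto

theorem sat_iff : (φ.iff ψ).Sat v ↔ (φ.Sat v ↔ ψ.Sat v) := by
  simp only [CFormula.iff, sat_and, Sat]
  tauto

theorem sat_top (θ : Θ) : (top θ).Sat v := fun h => h

end Sat

/-! ### Finite mixtures of valuations and their periodic models -/

namespace IsProbability

variable {θ : Θ} {π : CFormula Θ → ℝ}

theorem congr (hπ : IsProbability θ π) {φ ψ : CFormula Θ} (h : ∀ v, φ.Sat v ↔ ψ.Sat v) : π φ = π ψ :=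
  hπ.equivalence _ _ (provable_of_forall_sat fun v => sat_iff.2 (h v))

theorem eq_zero (hπ : IsProbability θ π) {φ : CFormula Θ} (h : ∀ v, ¬ φ.Sat v) : π φ = 0 := by
  rw [← hπ.coherence]
  exact hπ.congr fun v => iff_of_false (h v) fun h' => h' (sat_top θ)

theorem and_add_and_neg (hπ : IsProbability θ π) (φ ψ : CFormula Θ) : π (φ.and ψ) + π (φ.and ψ.neg) = π φ := by
  rw [← hπ.additivity, hπ.eq_zero (φ := (φ.and ψ).and _), zero_add]
  · refine hπ.congr fun v => ?_
    simp only [sat_or, sat_and, Sat]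
    tauto
  · intro v
    simp only [sat_and, Sat]
    tauto

open Classical in
/-- On finitely many formulas, a probability over `C` is a finite mixture of valuations. -/
theorem exists_mixture (hπ : IsProbability θ π) (F : List (CFormula Θ)) (c : CFormula Θ) :
    ∃ (ι : Type) (_ : Fintype ι) (w : ι → ℝ) (v : ι → Θ → Prop), (∀ i, 0 ≤ w i) ∧
      (∀ i, c.Sat (v i)) ∧ ∑ i, w i = π c ∧
      ∀ φ ∈ F, π (c.and φ) = ∑ i, if φ.Sat (v i) then w i else 0 := by
  -- The formula `c` records the decisions made so far, and each new `φ` splits it into `c ∧ φ` and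
  -- `c ∧ ¬φ`. A satisfiable leaf contributes one valuation of weight `π c`; an unsatisfiable one
  -- has weight zero and contributes nothing.
  induction F generalizing c with
  | nil =>
    by_cases hc : ∃ v, c.Sat v
    · obtain ⟨v, hv⟩ := hc
      exact ⟨Unit, inferInstance, fun _ => π c, fun _ => v, fun _ => hπ.nonneg c, fun _ => hv,
        by simp, by simp⟩
    · push Not at hc
      exact ⟨Empty, inferInstance, Empty.elim, Empty.elim, fun i => i.elim, fun i => i.elim,
        by simp [hπ.eq_zero hc], by simp⟩
  | cons φ F ih =>
    obtain ⟨ι, _, w, v, hw, hv, hsum, hF⟩ := ih (c.and φ)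
    obtain ⟨κ, _, w', v', hw', hv', hsum', hF'⟩ := ih (c.and φ.neg)
    simp only [sat_and, Sat] at hv hv'
    refine ⟨ι ⊕ κ, inferInstance, Sum.elim w w', Sum.elim v v', ?_, ?_, ?_, ?_⟩
    · rintro (i | i)
      exacts [hw i, hw' i]
    · rintro (i | i)
      exacts [(hv i).1, (hv' i).1]
    · rw [Fintype.sum_sum_type]
      simp only [Sum.elim_inl, Sum.elim_inr, hsum, hsum', hπ.and_add_and_neg]
    · intro ψ hψ
      rw [Fintype.sum_sum_type]
      rcases List.mem_cons.1 hψ with rfl | hψ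
      · simp only [Sum.elim_inl, Sum.elim_inr, (hv _).2, (hv' _).2, if_true, if_false, hsum, Finset.sum_const_zero, add_zero]
      · refine Eq.trans ?_ (congrArg₂ (· + ·) (hF ψ hψ) (hF' ψ hψ))
        rw [← hπ.and_add_and_neg (c.and ψ) φ]
        refine congrArg₂ (· + ·) ?_ ?_ <;>
        · refine hπ.congr fun v => ?_
          simp only [sat_and]
          tauto

end IsProbability

end CFormula

/-- Each `N * w i` is rounded down, and the total deficit, at most the number of indices, is
assigned to a single index `i₀`. -/
theorem exists_counts {ι : Type*} [Fintype ι] {w : ι → ℝ} (hw : ∀ i, 0 ≤ w i)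
    (hsum : ∑ i, w i = 1) (N : ℕ) :
    ∃ k : ι → ℕ, ∑ i, k i = N ∧ ∀ i, |k i - N * w i| ≤ Fintype.card ι := by
  classical
  have hN : (0 : ℝ) ≤ N := Nat.cast_nonneg N
  obtain ⟨i₀⟩ : Nonempty ι := by
    by_contra h
    rw [not_nonempty_iff] at h
    simp at hsum
  have hfl : ∀ i, (⌊N * w i⌋₊ : ℝ) ≤ N * w i := fun i => Nat.floor_le (mul_nonneg hN (hw i))
  have hfl' : ∀ i, N * w i ≤ ⌊N * w i⌋₊ + 1 := fun i => (Nat.lt_floor_add_one _).le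
  have hle : ∑ i, ⌊N * w i⌋₊ ≤ N := by
    rw [← Nat.cast_le (α := ℝ), Nat.cast_sum]
    refine (Finset.sum_le_sum fun i _ => hfl i).trans_eq ?_
    rw [← Finset.mul_sum, hsum, mul_one]
  have hge : (N : ℝ) ≤ (∑ i, ⌊N * w i⌋₊ : ℕ) + Fintype.card ι := by
    have := Finset.sum_le_sum fun i (_ : i ∈ Finset.univ) => hfl' i
    rw [← Finset.mul_sum, hsum, mul_one, Finset.sum_add_distrib] at this
    simpa using this
  have hcard : (1 : ℝ) ≤ Fintype.card ι := Nat.one_le_cast.2 (Fintype.card_pos_iff.2 ⟨i₀⟩)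
  refine ⟨fun i => ⌊N * w i⌋₊ + if i = i₀ then N - ∑ i, ⌊N * w i⌋₊ else 0, ?_, fun i => ?_⟩
  · rw [Finset.sum_add_distrib, Finset.sum_ite_eq' Finset.univ i₀, if_pos (Finset.mem_univ _)]
    omega
  · have := hfl i
    have := hfl' i
    rw [abs_le]
    dsimp only
    split_ifs
    · have : (0 : ℝ) ≤ N - (∑ i, ⌊N * w i⌋₊ : ℕ) := sub_nonneg.2 (Nat.cast_le.2 hle)
      rw [Nat.cast_add, Nat.cast_sub hle]
      constructor <;> linarith
    · rw [add_zero]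
      constructor <;> linarith

-- The residues modulo `N` are labelled by indices, with `k i` residues receiving the valuation `v
-- i`; density then counts labels. The operation `h` is arbitrary because classical formulas contain
-- no conditional.
open Classical in
theorem exists_periodic_model {Θ ι : Type*} [Fintype ι] (v : ι → Θ → Prop) {k : ι → ℕ} {N : ℕ}
    (hN : 0 < N) (hk : ∑ i, k i = N) (h : periodicSets → periodicSets → periodicSets) :
    ∃ V : Θ → periodicSets, ∀ φ : CFormula Θ, density (φ.toFormula.eval h V) =
      (∑ i, if φ.Sat (v i) then (k i : ℝ) else 0) / N := by
  have e : Fin N ≃ Σ i, Fin (k i) := (Fintype.equivFinOfCardEq (by simp [hk])).symm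
  let g : ℕ → ι := fun x => (e ⟨x % N, Nat.mod_lt x hN⟩).1
  have hg : Periodic g N := fun x => by simp only [g, Nat.add_mod_right]
  let V : Θ → periodicSets := fun θ =>
    ⟨{x | v (g x) θ}, N, hN, fun x => by simp only [mem_ofPred_eq, hg x]⟩
  have hmem : ∀ (φ : CFormula Θ) (x : ℕ),
      x ∈ ((φ.toFormula.eval h V : periodicSets) : Set ℕ) ↔ φ.Sat (v (g x)) := by
    intro φ x
    induction φ with
    | atom θ => exact Iff.rfl
    | neg φ ih =>
      rw [CFormula.Sat, ← ih]
      exact Iff.rfl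
    | imp φ ψ ih₁ ih₂ =>
      rw [CFormula.Sat, ← ih₁, ← ih₂, CFormula.toFormula, Formula.eval, himp_eq]
      change _ ∨ ¬ _ ↔ _
      tauto
  refine ⟨V, fun φ => ?_⟩
  have hper : HasPeriod N (φ.toFormula.eval h V) := fun x => propext (by
    dsimp only
    rw [hmem, hmem, hg x])
  rw [hper.density_eq hN]
  congr 1
  have h₁ : ∀ x : Fin N, ((φ.toFormula.eval h V : periodicSets) : Set ℕ).indicator (1 : ℕ → ℝ) x =
      if φ.Sat (v (e x).1) then 1 else 0 := by
    intro x
    have : g x = (e x).1 := by simp only [g, Nat.mod_eq_of_lt x.2, Fin.eta]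
    rw [← this]
    by_cases hx : φ.Sat (v (g x))
    · rw [indicator_of_mem ((hmem φ x).2 hx), if_pos hx, Pi.one_apply]
    · rw [indicator_of_notMem (mt (hmem φ x).1 hx), if_neg hx]
  rw [countBelow, Finset.sum_range, Finset.sum_congr rfl fun x _ => h₁ x,
    Equiv.sum_comp e fun p => if φ.Sat (v p.1) then (1 : ℝ) else 0, Fintype.sum_sigma]
  refine Finset.sum_congr rfl fun i _ => ?_
  by_cases hi : φ.Sat (v i) <;> simp [hi]

/-! ### Closedness and compactness -/

namespace Formula

variable {Θ : Type*}

/-- Each condition is an equality or inequality between continuous functions of finitely many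
coordinates, hence closed in the product topology. -/
theorem isClosed_isProbability (θ : Θ) : IsClosed {P : Formula Θ → ℝ | IsProbability θ P} := by
  have : {P : Formula Θ → ℝ | IsProbability θ P} =
      (⋂ φ, {P | 0 ≤ P φ}) ∩ (⋂ φ, ⋂ ψ, ⋂ _ : Equivalent φ ψ, {P | P φ = P ψ}) ∩
      (⋂ φ, ⋂ ψ, {P | P (and φ ψ) + P (or φ ψ) = P φ + P ψ}) ∩
      {P | P (bot θ) = 0} ∩ {P | P (top θ) = 1} ∩
      (⋂ φ, ⋂ ψ, ⋂ _ : Provable (indep φ ψ), {P | P (and φ ψ) = P φ * P ψ}) := by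
    ext P
    simp only [mem_inter_iff, mem_iInter, mem_ofPred_eq]
    exact ⟨fun h => ⟨⟨⟨⟨⟨h.1, h.2⟩, h.3⟩, h.4⟩, h.5⟩, h.6⟩,
      fun ⟨⟨⟨⟨⟨h₁, h₂⟩, h₃⟩, h₄⟩, h₅⟩, h₆⟩ => ⟨h₁, h₂, h₃, h₄, h₅, h₆⟩⟩
  rw [this]
  refine ((((IsClosed.inter ?_ ?_).inter ?_).inter ?_).inter ?_).inter ?_
  · exact isClosed_iInter fun φ => isClosed_le (by fun_prop) (by fun_prop)
  · exact isClosed_iInter fun φ => isClosed_iInter fun ψ => isClosed_iInter fun _ =>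
      isClosed_eq (by fun_prop) (by fun_prop)
  · exact isClosed_iInter fun φ => isClosed_iInter fun ψ =>
      isClosed_eq (by fun_prop) (by fun_prop)
  · exact isClosed_eq (by fun_prop) (by fun_prop)
  · exact isClosed_eq (by fun_prop) (by fun_prop)
  · exact isClosed_iInter fun φ => isClosed_iInter fun ψ => isClosed_iInter fun _ =>
      isClosed_eq (by fun_prop) (by fun_prop)

end Formula

open Classical in
/-- On finitely many classical formulas, a probability over `C` is approximated by a probability
over DmBL. -/
theorem CFormula.IsProbability.exists_approx {Θ : Type*} {θ : Θ} {π : CFormula Θ → ℝ}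
    (hπ : IsProbability θ π) (F : Finset (CFormula Θ)) {ε : ℝ} (hε : 0 < ε) :
    ∃ P : Formula Θ → ℝ, Formula.IsProbability θ P ∧ (∀ φ, P φ ≤ 1) ∧
      ∀ φ ∈ F, |P φ.toFormula - π φ| ≤ ε := by
  obtain ⟨h, hh, hm⟩ := exists_isConditioning_density
  obtain ⟨ι, _, w, v, hw, -, hsum, hF⟩ := hπ.exists_mixture F.toList (top θ)
  rw [hπ.finiteness] at hsum
  -- Each of the `card ι` counts is off by at most `card ι`, so the total error after division by
  -- `N` is at most `card ι ^ 2 / N`.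
  obtain ⟨N, hN⟩ := exists_nat_gt ((Fintype.card ι : ℝ) * Fintype.card ι / ε)
  have hN0 : (0 : ℝ) < N := hN.trans_le' (by positivity)
  obtain ⟨k, hk, hkw⟩ := exists_counts hw hsum N
  obtain ⟨V, hV⟩ := exists_periodic_model v (Nat.cast_pos.1 hN0) hk h
  refine ⟨_, Formula.isProbability_eval (v := V) hh isCharge_density hm θ,
    fun φ => isCharge_density.le_one _, fun φ hφ => ?_⟩
  have hπφ : π φ = ∑ i, if φ.Sat (v i) then w i else 0 := by
    rw [← hF φ (Finset.mem_toList.2 hφ)]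
    exact hπ.congr fun v => by simp only [sat_and, sat_top, true_and]
  rw [hV, hπφ, div_sub' hN0.ne', abs_div, abs_of_pos hN0, div_le_iff₀ hN0, Finset.mul_sum,
    ← Finset.sum_sub_distrib]
  refine (Finset.abs_sum_le_sum_abs _ _).trans ((Finset.sum_le_card_nsmul _ _
    (Fintype.card ι : ℝ) fun i _ => ?_).trans ?_)
  · split_ifs
    · exact hkw i
    · simp
  · rw [div_lt_iff₀ hε] at hN
    rw [nsmul_eq_mul, Finset.card_univ]
    linarith

end DmBL

theorem mainTheorem1 {Θ : Type*} (θ : Θ) (π : DmBL.CFormula Θ → ℝ)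
    (hπ : DmBL.CFormula.IsProbability θ π) :
    ∃ P : DmBL.Formula Θ → ℝ, DmBL.Formula.IsProbability θ P ∧
      ∀ φ : DmBL.CFormula Θ, P φ.toFormula = π φ := by
  classical
  have hK : IsCompact (Set.pi Set.univ (fun _ : DmBL.Formula Θ => Set.Icc (0 : ℝ) 1) ∩
      {P | DmBL.Formula.IsProbability θ P}) :=
    (isCompact_univ_pi fun _ => isCompact_Icc).inter_right
      (DmBL.Formula.isClosed_isProbability θ)
  -- Finite intersection property: finitely many constraints `(φ, n)` are met by one approximation
  -- at the smallest tolerance, that of the largest `n`.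
  obtain ⟨P, ⟨-, hP⟩, hPt⟩ := hK.inter_iInter_nonempty
    (fun p : DmBL.CFormula Θ × ℕ => {P | |P p.1.toFormula - π p.1| ≤ 1 / ((p.2 : ℝ) + 1)})
    (fun p => isClosed_le (by fun_prop) (by fun_prop)) fun u => by
      obtain ⟨P, hP, hP1, hPF⟩ := hπ.exists_approx (u.image Prod.fst)
        (ε := 1 / ((u.sup Prod.snd : ℕ) + 1)) (by positivity)
      refine ⟨P, ⟨fun φ _ => ⟨hP.nonneg φ, hP1 φ⟩, hP⟩, Set.mem_iInter₂.2 fun p hp => ?_⟩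
      refine (hPF p.1 (Finset.mem_image_of_mem _ hp)).trans ?_
      have : p.2 ≤ u.sup Prod.snd := Finset.le_sup (f := Prod.snd) hp
      exact one_div_le_one_div_of_le (by positivity) (by exact_mod_cast Nat.succ_le_succ this)
  refine ⟨P, hP, fun φ => ?_⟩
  refine sub_eq_zero.1 (abs_eq_zero.1 (le_antisymm (le_of_forall_pos_le_add fun ε hε => ?_)
    (abs_nonneg _)))
  obtain ⟨n, hn⟩ := exists_nat_one_div_lt hε
  rw [zero_add]
  exact (Set.mem_iInter.1 hPt (φ, n)).trans hn.le
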